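/- Proposition 3.4. Let $p,q\ge 0$ and $r,s\ge 0$ be integers, put $i=r+s+1$, and let $b$ be the standard symmetric bilinear form of signature $(p,q)$ on $\mathbb R^{p+q}$. Let $Gr(i,\mathbb R^{p+q})$ be the Grassmannian of $i$-dimensional linear subspaces of $\mathbb R^{p+q}$, with its usual smooth structure, and let $E$ be its tautological bundle, whose fibre over $V$ is $V$ itself. Let $L=S^2(\Lambda^iE^*)$ be the smooth line bundle whose fibre over $V$ consists of the symmetric bilinear forms on $\Lambda^iV$, and let $\sigma_i$ be the section of $L$ whose value at $V$ is the restriction to $\Lambda^iV$ of the form induced by $b$ on $\Lambda^i\mathbb R^{p+q}$, i.e. $$\sigma_i(V)(v_1\wedge\dots\wedge v_i,\;w_1\wedge\dots\wedge w_i)=\det\bigl(b(v_j,w_k)\bigr)_{j,k=1,\dots,i}.$$ Let $\mathcal O_{(r,s)}\subset Gr(i,\mathbb R^{p+q})$ be the set of all $V$ such that $b|_{V\times V}$ has signature $(r,s)$. A section $\sigma$ of $L$ is called a defining density for a subset $N\subset Gr(i,\mathbb R^{p+q})$ if $N$ is an embedded smooth submanifold of codimension one, $\sigma$ is smooth, and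 for every $y\in N$ one has $\sigma(y)=0$ and the linear map $\nabla\sigma(y):T_yGr(i,\mathbb R^{p+q})\to L_y$ is surjective (i.e. non-zero) for every linear connection $\nabla$ on $L$ (it does not depend on $\nabla$, since $\sigma(y)=0$). Then $\sigma_i$ is a defining density for $\mathcal O_{(r,s)}$, and also for each single orbit of $SO(p,q)$ that is contained in $\mathcal O_{(r,s)}$. -/

import Mathlib

open Set Bundle Topology
open scoped Manifold ContDiff

noncomputable section

set_option linter.unusedSectionVars false

/-! ### Submanifolds and defining sections -/

section DefiningSection

variable {E : Type*} [NormedAddCommGroup E] [NormedSpace ℝ E]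
  {M : Type*} [TopologicalSpace M] [ChartedSpace E M]

/-- `N` is an embedded smooth submanifold of codimension `k` in the smooth manifold `M`: around each
point of `N` there is a smooth chart of `M` in which `N` is a linear subspace of codimension `k`. -/
def IsEmbeddedSubmanifold (N : Set M) (k : ℕ) : Prop :=
  ∀ x ∈ N, ∃ φ ∈ IsManifold.maximalAtlas 𝓘(ℝ, E) ∞ M, x ∈ φ.source ∧
    ∃ W : Submodule ℝ E, Module.finrank ℝ (E ⧸ W) = k ∧ IsClosed (W : Set E) ∧
      N ∩ φ.source = φ.source ∩ φ ⁻¹' W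

variable (F : Type*) [NormedAddCommGroup F] [NormedSpace ℝ F]
  {L : M → Type*} [TopologicalSpace (TotalSpace F L)]
  [∀ x, AddCommGroup (L x)] [∀ x, Module ℝ (L x)] [∀ x, TopologicalSpace (L x)]
  [∀ x, IsTopologicalAddGroup (L x)] [∀ x, ContinuousSMul ℝ (L x)]
  [FiberBundle F L] [VectorBundle ℝ F L] [ContMDiffVectorBundle ∞ F L 𝓘(ℝ, E)]

/-- There are linear connections on `L`. (Here a linear connection is only required to satisfy the
pointwise Leibniz rule, so there is no need to glue local connections smoothly.) -/
theorem nonempty_covariantDerivative : Nonempty (CovariantDerivative 𝓘(ℝ, E) F L) := by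
  classical
  have key (σ : ∀ x, L x) (x : M) (hσ : MDifferentiableAt 𝓘(ℝ, E) (𝓘(ℝ, E).prod 𝓘(ℝ, F))
      (fun y => TotalSpace.mk' F y (σ y)) x) : MDifferentiableAt 𝓘(ℝ, E) 𝓘(ℝ, F)
      (fun y => (trivializationAt F L x).continuousLinearMapAt ℝ y (σ y)) x := by
    refine ((mdifferentiableAt_section _ _).1 hσ).congr_of_eventuallyEq ?_
    filter_upwards [(trivializationAt F L x).open_baseSet.mem_nhds
      (mem_baseSet_trivializationAt F L x)] with y hy
    rw [Trivialization.continuousLinearMapAt_apply, Trivialization.linearMapAt_apply, if_pos hy]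
  refine ⟨⟨fun σ x => ((trivializationAt F L x).symmL ℝ x).comp
    (mvfderiv 𝓘(ℝ, E)
      (fun y => (trivializationAt F L x).continuousLinearMapAt ℝ y (σ y)) x), ?_, ?_⟩⟩
  · intro σ σ' x hσ hσ' _
    rw [← ContinuousLinearMap.comp_add, ← mvfderiv_add (key σ x hσ) (key σ' x hσ')]
    congr 2
    ext y
    simp
  · intro σ g x hσ hg _
    have h1 : (fun y => (trivializationAt F L x).continuousLinearMapAt ℝ y ((g • σ) y)) =
        g • fun y => (trivializationAt F L x).continuousLinearMapAt ℝ y (σ y) := by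
      ext y
      simp
    rw [h1, mvfderiv_smul hg (key σ x hσ)]
    ext v
    simp [mem_baseSet_trivializationAt]

variable (E) in
/-- The smooth section `σ` of the smooth vector bundle `L → M` with model fibre `F` is a defining
section for `N`: the set `N` is an embedded submanifold whose codimension is the rank of `L`, and in
each point `y` of `N` the section `σ` vanishes and the linear map `∇σ(y) : T_y M → L_y` is
surjective. This map does not depend on the choice of the linear connection `∇` since `σ(y) = 0`;
surjectivity is required for all of them. -/
structure IsDefiningSection (σ : ∀ x, L x) (N : Set M) : Prop where
  isEmbeddedSubmanifold : IsEmbeddedSubmanifold (E := E) N (Module.finrank ℝ F)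
  contMDiff : ContMDiff 𝓘(ℝ, E) (𝓘(ℝ, E).prod 𝓘(ℝ, F)) ∞ fun x => TotalSpace.mk' F x (σ x)
  eq_zero : ∀ y ∈ N, σ y = 0
  surjective : ∀ (cov : CovariantDerivative 𝓘(ℝ, E) F L), ∀ y ∈ N, Function.Surjective (cov σ y)

end DefiningSection

/-! ### The Grassmannian as a smooth manifold -/

/-- The Grassmannian `Gr(i, X)` of `i`-dimensional linear subspaces of a real vector space `X`. -/
def RealGrassmannian (i : ℕ) (X : Type*) [AddCommGroup X] [Module ℝ X] : Type _ :=
  {V : Submodule ℝ X // Module.finrank ℝ V = i}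

namespace RealGrassmannian

variable (i : ℕ) (X : Type*) [NormedAddCommGroup X] [NormedSpace ℝ X] [FiniteDimensional ℝ X]

/-- `ℝ^i`, the model for the points of the Grassmannian. -/
abbrev Sub : Type := Fin i → ℝ

/-- `ℝ^(n-i)`, with `n = dim X`, the model for the quotients by the points of the Grassmannian. -/
abbrev Quo : Type := Fin (Module.finrank ℝ X - i) → ℝ

/-- The model space `L(ℝ^i, ℝ^(n-i))` of the Grassmannian. -/
abbrev Model : Type := Sub i →L[ℝ] Quo i X

/-- A linear isomorphism `X ≅ ℝ^i × ℝ^(n-i)`; each of these gives a chart. -/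
abbrev Splitting : Type _ := X ≃L[ℝ] Sub i × Quo i X

variable {i X}

/-- The subspace of `X` that corresponds to the graph of `A` under the splitting `e`. -/
def graphAt (e : Splitting i X) (A : Model i X) : RealGrassmannian i X :=
  ⟨(LinearMap.graph (A : Sub i →ₗ[ℝ] Quo i X)).comap
      (e.toLinearEquiv : X →ₗ[ℝ] Sub i × Quo i X), by
    rw [Submodule.comap_equiv_eq_map_symm, LinearEquiv.finrank_map_eq, LinearMap.graph_eq_range_prod,
      LinearMap.finrank_range_of_inj (fun u v h => (Prod.ext_iff.1 h).1)]
    simp⟩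

theorem mem_graphAt {e : Splitting i X} {A : Model i X} {v : X} :
    v ∈ (graphAt e A).1 ↔ (e v).2 = A (e v).1 := Iff.rfl

/-- The `ℝ^i`-component of the splitting `e'` on the graph of `A` in the splitting `e`. -/
def subComp (e e' : Splitting i X) (A : Model i X) : Sub i →L[ℝ] Sub i :=
  (ContinuousLinearMap.fst ℝ (Sub i) (Quo i X)).comp
    ((e.symm.trans e' : (Sub i × Quo i X) →L[ℝ] (Sub i × Quo i X)).comp
      ((ContinuousLinearMap.id ℝ (Sub i)).prod A))

/-- The `ℝ^(n-i)`-component of the splitting `e'` on the graph of `A` in the splitting `e`. -/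
def quoComp (e e' : Splitting i X) (A : Model i X) : Sub i →L[ℝ] Quo i X :=
  (ContinuousLinearMap.snd ℝ (Sub i) (Quo i X)).comp
    ((e.symm.trans e' : (Sub i × Quo i X) →L[ℝ] (Sub i × Quo i X)).comp
      ((ContinuousLinearMap.id ℝ (Sub i)).prod A))

theorem subComp_apply (e e' : Splitting i X) (A : Model i X) (u : Sub i) :
    subComp e e' A u = (e' (e.symm (u, A u))).1 := rfl

theorem quoComp_apply (e e' : Splitting i X) (A : Model i X) (u : Sub i) :
    quoComp e e' A u = (e' (e.symm (u, A u))).2 := rfl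

theorem symm_mem_graphAt (e : Splitting i X) (A : Model i X) (u : Sub i) :
    e.symm (u, A u) ∈ (graphAt e A).1 := by simp [mem_graphAt]

theorem graphAt_eq_iff {e e' : Splitting i X} {A A' : Model i X} :
    graphAt e A = graphAt e' A' ↔ quoComp e e' A = A'.comp (subComp e e' A) := by
  constructor
  · intro h
    ext1 u
    have := symm_mem_graphAt e A u
    rw [h, mem_graphAt] at this
    exact this
  · intro h
    apply Subtype.ext
    refine Submodule.eq_of_le_of_finrank_eq (fun v hv => ?_) ?_
    · rw [mem_graphAt] at hv ⊢
      have hv' : v = e.symm ((e v).1, A (e v).1) := by rw [← hv]; simp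
      rw [hv']
      exact DFunLike.congr_fun h (e v).1
    · rw [(graphAt e A).2, (graphAt e' A').2]

theorem graphAt_injective (e : Splitting i X) : Function.Injective (graphAt e) := by
  intro A A' h
  have := graphAt_eq_iff.1 h
  ext1 u
  have := DFunLike.congr_fun this u
  simpa [quoComp_apply, subComp_apply] using this

theorem isUnit_subComp {e e' : Splitting i X} {A A' : Model i X}
    (h : graphAt e A = graphAt e' A') : IsUnit (subComp e e' A) := by
  have hc := graphAt_eq_iff.1 h
  have hinj : Function.Injective (subComp e e' A) := by
    rw [injective_iff_map_eq_zero]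
    intro u hu
    have h2 : quoComp e e' A u = 0 := by rw [hc]; simp [hu]
    have h3 : e' (e.symm (u, A u)) = 0 := Prod.ext hu h2
    exact (by simpa using h3 : u = 0 ∧ A u = 0).1
  rw [ContinuousLinearMap.isUnit_iff_bijective]
  exact ⟨hinj, (LinearMap.injective_iff_surjective (f := (subComp e e' A : Sub i →ₗ[ℝ] Sub i))).1 hinj⟩

theorem graphAt_eq_of_isUnit {e e' : Splitting i X} {A : Model i X}
    (h : IsUnit (subComp e e' A)) :
    graphAt e' ((quoComp e e' A).comp (Ring.inverse (subComp e e' A))) = graphAt e A := by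
  symm
  rw [graphAt_eq_iff, ContinuousLinearMap.comp_assoc]
  have : (Ring.inverse (subComp e e' A)).comp (subComp e e' A) = ContinuousLinearMap.id ℝ _ :=
    Ring.inverse_mul_cancel _ h
  rw [this, ContinuousLinearMap.comp_id]

theorem contDiff_subComp (e e' : Splitting i X) {n : ℕ∞ω} : ContDiff ℝ n (subComp e e') := by
  refine contDiff_const.clm_comp (contDiff_const.clm_comp ?_)
  have : ContDiff ℝ n (fun A : Model i X =>
      (ContinuousLinearMap.inl ℝ (Sub i) (Quo i X)).comp (ContinuousLinearMap.id ℝ (Sub i)) +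
      (ContinuousLinearMap.inr ℝ (Sub i) (Quo i X)).comp A) :=
    contDiff_const.add (contDiff_const.clm_comp contDiff_id)
  convert this using 2 with A
  ext u <;> simp

theorem contDiff_quoComp (e e' : Splitting i X) {n : ℕ∞ω} : ContDiff ℝ n (quoComp e e') := by
  refine contDiff_const.clm_comp (contDiff_const.clm_comp ?_)
  have : ContDiff ℝ n (fun A : Model i X =>
      (ContinuousLinearMap.inl ℝ (Sub i) (Quo i X)).comp (ContinuousLinearMap.id ℝ (Sub i)) +
      (ContinuousLinearMap.inr ℝ (Sub i) (Quo i X)).comp A) :=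
    contDiff_const.add (contDiff_const.clm_comp contDiff_id)
  convert this using 2 with A
  ext u <;> simp

/-- The chart of the Grassmannian given by a splitting `e`: it is defined on the set of those
subspaces that are graphs in `e`, and maps the graph of `A` to `A`. -/
def grChart (e : Splitting i X) : PartialEquiv (RealGrassmannian i X) (Model i X) :=
  ((graphAt_injective e).injOn (s := univ)).toPartialEquiv.symm

theorem grChart_symm (e : Splitting i X) (A : Model i X) : (grChart e).symm A = graphAt e A := rfl

theorem grChart_target (e : Splitting i X) : (grChart e).target = univ := rfl

theorem mem_grChart_source {e : Splitting i X} {V : RealGrassmannian i X} :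
    V ∈ (grChart e).source ↔ ∃ A, graphAt e A = V := by
  simp [grChart]

theorem grChart_graphAt (e : Splitting i X) (A : Model i X) : grChart e (graphAt e A) = A :=
  (grChart e).right_inv (x := A) (mem_univ A)

theorem graphAt_grChart {e : Splitting i X} {V : RealGrassmannian i X}
    (h : V ∈ (grChart e).source) : graphAt e (grChart e V) = V :=
  (grChart e).left_inv h

theorem grChart_trans_source (e e' : Splitting i X) :
    ((grChart e).symm.trans (grChart e')).source = {A | IsUnit (subComp e e' A)} := by
  ext A
  simp only [PartialEquiv.trans_source, PartialEquiv.symm_source, grChart_target, univ_inter,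
    mem_preimage, grChart_symm, mem_grChart_source, mem_ofPred_eq]
  exact ⟨fun ⟨A', h⟩ => isUnit_subComp h.symm, fun h => ⟨_, graphAt_eq_of_isUnit h⟩⟩

theorem grChart_trans_contDiffOn (e e' : Splitting i X) {n : ℕ∞ω} :
    ContDiffOn ℝ n ((grChart e).symm.trans (grChart e'))
      ((grChart e).symm.trans (grChart e')).source := by
  rw [grChart_trans_source]
  have : ContDiffOn ℝ n (fun A => (quoComp e e' A).comp (Ring.inverse (subComp e e' A)))
      {A | IsUnit (subComp e e' A)} := by
    intro A hA
    obtain ⟨x, hx⟩ := (hA : IsUnit _)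
    refine ContDiffAt.contDiffWithinAt ?_
    refine (contDiff_quoComp e e').contDiffAt.clm_comp ?_
    have h1 : ContDiffAt ℝ n (Ring.inverse : (Sub i →L[ℝ] Sub i) → _) (subComp e e' A) := by
      rw [← hx]; exact contDiffAt_ringInverse ℝ x
    exact h1.comp A (contDiff_subComp e e').contDiffAt
  refine this.congr fun A hA => ?_
  have := graphAt_eq_of_isUnit hA
  simp only [PartialEquiv.coe_trans, Function.comp_apply, grChart_symm, ← this, grChart_graphAt]

theorem exists_splitting (V : RealGrassmannian i X) :
    ∃ e : Splitting i X, V ∈ (grChart e).source := by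
  obtain ⟨W, hW⟩ := Submodule.exists_isCompl V.1
  have hV : Module.finrank ℝ V.1 = Module.finrank ℝ (Sub i) := by simpa using V.2
  have hW' : Module.finrank ℝ W = Module.finrank ℝ (Quo i X) := by
    have := Submodule.finrank_add_eq_of_isCompl hW
    rw [V.2] at this
    simp only [Module.finrank_fintype_fun_eq_card, Fintype.card_fin]
    omega
  let e : X ≃ₗ[ℝ] Sub i × Quo i X := (Submodule.prodEquivOfIsCompl V.1 W hW).symm.trans
    ((LinearEquiv.ofFinrankEq _ _ hV).prodCongr (LinearEquiv.ofFinrankEq _ _ hW'))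
  refine ⟨e.toContinuousLinearEquiv, mem_grChart_source.2 ⟨0, Subtype.ext ?_⟩⟩
  ext v
  rw [mem_graphAt]
  simp [e]

/-- A splitting whose chart is defined at `V`. -/
def splittingAt (V : RealGrassmannian i X) : Splitting i X := (exists_splitting V).choose

theorem mem_splittingAt (V : RealGrassmannian i X) : V ∈ (grChart (splittingAt V)).source :=
  (exists_splitting V).choose_spec

variable (i X) in
/-- The atlas of the Grassmannian that consists of the charts of all splittings. -/
def chartCore : ChartedSpaceCore (Model i X) (RealGrassmannian i X) where
  atlas := range grChart
  chartAt V := grChart (splittingAt V)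
  mem_chart_source := mem_splittingAt
  chart_mem_atlas V := mem_range_self _
  open_source := by
    rintro _ _ ⟨e, rfl⟩ ⟨e', rfl⟩
    rw [grChart_trans_source]
    exact Units.isOpen.preimage (contDiff_subComp e e' (n := 0)).continuous
  continuousOn_toFun := by
    rintro _ _ ⟨e, rfl⟩ ⟨e', rfl⟩
    exact (grChart_trans_contDiffOn e e' (n := 0)).continuousOn

instance : TopologicalSpace (RealGrassmannian i X) := (chartCore i X).toTopologicalSpace

instance : ChartedSpace (Model i X) (RealGrassmannian i X) := (chartCore i X).toChartedSpace

/-- The chart of a splitting, as a homeomorphism between open sets. -/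
def grHomeo (e : Splitting i X) : OpenPartialHomeomorph (RealGrassmannian i X) (Model i X) :=
  (chartCore i X).openPartialHomeomorph (grChart e) (mem_range_self e)

theorem grHomeo_toPartialEquiv (e : Splitting i X) : (grHomeo e).toPartialEquiv = grChart e := rfl

theorem grHomeo_mem_atlas (e : Splitting i X) :
    grHomeo e ∈ atlas (Model i X) (RealGrassmannian i X) := by
  exact mem_iUnion₂.2 ⟨grChart e, mem_range_self e, rfl⟩

theorem exists_of_mem_atlas {φ : OpenPartialHomeomorph (RealGrassmannian i X) (Model i X)}
    (h : φ ∈ atlas (Model i X) (RealGrassmannian i X)) : ∃ e, φ = grHomeo e := by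
  obtain ⟨_, ⟨e, rfl⟩, h⟩ := mem_iUnion₂.1 h
  exact ⟨e, h⟩

instance : IsManifold 𝓘(ℝ, Model i X) ∞ (RealGrassmannian i X) := by
  refine isManifold_of_contDiffOn _ _ _ fun φ φ' h h' => ?_
  obtain ⟨e, rfl⟩ := exists_of_mem_atlas h
  obtain ⟨e', rfl⟩ := exists_of_mem_atlas h'
  have := grChart_trans_contDiffOn e e' (n := ∞)
  simpa using! this

/-- `S²(Λ^k V^*)`: the symmetric bilinear forms on the `k`-th exterior power of `V`. -/
def symForms (k : ℕ) (V : Type*) [AddCommGroup V] [Module ℝ V] :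
    Submodule ℝ (LinearMap.BilinForm ℝ (⋀[ℝ]^k V)) where
  carrier := {B | B.IsSymm}
  add_mem' h h' := h.add h'
  zero_mem' := ⟨fun _ _ => rfl⟩
  smul_mem' c _ h := h.smul c

/-- The fibre over `V` of the line bundle `L = S²(Λ^i E^*)`, where `E` is the tautological bundle
of the Grassmannian, whose fibre over `V` is `V` itself. -/
def Density (V : RealGrassmannian i X) : Type _ := symForms i V.1

instance (V : RealGrassmannian i X) : AddCommGroup (Density V) :=
  Module.addCommMonoidToAddCommGroup ℝ (M := symForms i V.1)

instance (V : RealGrassmannian i X) : Module ℝ (Density V) :=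
  inferInstanceAs (Module ℝ (symForms i V.1))

/-- The values of an element of `L_V` on pairs of elements of `Λ^i V`. -/
def evalForm (V : RealGrassmannian i X) : Density V →ₗ[ℝ] (⋀[ℝ]^i V.1 → ⋀[ℝ]^i V.1 → ℝ) where
  toFun B x y := B.1 x y
  map_add' _ _ := rfl
  map_smul' _ _ := rfl

/-- The usual topology of the finite-dimensional space `L_V`: pointwise convergence of forms. -/
instance (V : RealGrassmannian i X) : TopologicalSpace (Density V) :=
  TopologicalSpace.induced (evalForm V) inferInstance

instance (V : RealGrassmannian i X) : IsTopologicalAddGroup (Density V) :=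
  topologicalAddGroup_induced (evalForm V)

instance (V : RealGrassmannian i X) : ContinuousSMul ℝ (Density V) :=
  continuousSMul_induced (evalForm V)

/-- For a subspace `V` that is a graph in the splitting `e`, the frame of `V` whose members have
the standard basis vectors of `ℝ^i` as their first components. -/
def frameAt (e : Splitting i X) (V : RealGrassmannian i X) (j : Fin i) : V.1 := by
  classical exact
  if h : V ∈ (grChart e).source then
    ⟨e.symm (Pi.single j 1, grChart e V (Pi.single j 1)), by
      have := symm_mem_graphAt e (grChart e V) (Pi.single j 1)
      rwa [graphAt_grChart h] at this⟩
  else 0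

theorem coe_frameAt {e : Splitting i X} {V : RealGrassmannian i X} (h : V ∈ (grChart e).source)
    (j : Fin i) :
    (frameAt e V j : X) = e.symm (Pi.single j 1, grChart e V (Pi.single j 1)) := by
  simp [frameAt, h]

/-- The exterior product of the members of the frame of `V` in the splitting `e`. -/
def wedgeAt (e : Splitting i X) (V : RealGrassmannian i X) : ⋀[ℝ]^i V.1 :=
  exteriorPower.ιMulti ℝ i (frameAt e V)

/-- The `i`-form on `V` that is the determinant of the first components in the splitting `e`. -/
def volAt (e : Splitting i X) (V : RealGrassmannian i X) : ⋀[ℝ]^i V.1 →ₗ[ℝ] ℝ :=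
  exteriorPower.alternatingMapLinearEquiv
    ((Pi.basisFun ℝ (Fin i)).det.compLinearMap
      ((LinearMap.fst ℝ (Sub i) (Quo i X)).comp
        ((e.toLinearEquiv : X →ₗ[ℝ] Sub i × Quo i X).comp V.1.subtype)))

theorem volAt_wedgeAt (e e' : Splitting i X) {V : RealGrassmannian i X}
    (h : V ∈ (grChart e').source) :
    volAt e V (wedgeAt e' V) =
      Matrix.det (Matrix.of fun j k => subComp e' e (grChart e' V) (Pi.single k 1) j) := by
  rw [volAt, wedgeAt, exteriorPower.alternatingMapLinearEquiv_apply_ιMulti]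
  simp only [AlternatingMap.compLinearMap_apply, Module.Basis.det_apply]
  congr 1
  ext j k
  simp [Module.Basis.toMatrix_apply, coe_frameAt h, subComp_apply]

theorem volAt_wedgeAt_self {e : Splitting i X} {V : RealGrassmannian i X}
    (h : V ∈ (grChart e).source) : volAt e V (wedgeAt e V) = 1 := by
  rw [volAt_wedgeAt e e h, ← Matrix.det_one (n := Fin i)]
  congr 1
  ext j k
  simp [subComp_apply, Matrix.one_apply, Pi.single_apply]

theorem volAt_smul_wedgeAt {e : Splitting i X} {V : RealGrassmannian i X}
    (h : V ∈ (grChart e).source) (x : ⋀[ℝ]^i V.1) : volAt e V x • wedgeAt e V = x := by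
  have hne : wedgeAt e V ≠ 0 := fun h0 => by
    have := volAt_wedgeAt_self h
    simp [h0] at this
  have h1 : Module.finrank ℝ (⋀[ℝ]^i V.1) = 1 := by
    rw [exteriorPower.finrank_eq, V.2, Nat.choose_self]
  obtain ⟨c, rfl⟩ := (finrank_eq_one_iff_of_nonzero' _ hne).1 h1 x
  rw [map_smul, volAt_wedgeAt_self h, smul_eq_mul, mul_one]

/-- The square of the `i`-form `volAt e V`, as an element of `L_V`. -/
def volSqAt (e : Splitting i X) (V : RealGrassmannian i X) : Density V :=
  ⟨(LinearMap.mul ℝ ℝ).compl₁₂ (volAt e V) (volAt e V), ⟨fun x y => by simp [mul_comm]⟩⟩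

theorem evalForm_volSqAt (e : Splitting i X) (V : RealGrassmannian i X) (x y : ⋀[ℝ]^i V.1) :
    evalForm V (volSqAt e V) x y = volAt e V x * volAt e V y := rfl

theorem evalForm_smul_volSqAt {e : Splitting i X} {V : RealGrassmannian i X}
    (h : V ∈ (grChart e).source) (B : Density V) :
    evalForm V B (wedgeAt e V) (wedgeAt e V) • volSqAt e V = B := by
  apply Subtype.ext
  refine LinearMap.ext fun x => LinearMap.ext fun y => ?_
  change B.1 (wedgeAt e V) (wedgeAt e V) * (volAt e V x * volAt e V y) = B.1 x y
  conv_rhs => rw [← volAt_smul_wedgeAt h x, ← volAt_smul_wedgeAt h y]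
  simp
  ring

theorem isOpen_grChart_source (e : Splitting i X) : IsOpen (grChart e).source :=
  (grHomeo e).open_source

/-- The local trivialization of `L` over the chart domain of the splitting `e`: a form is mapped to
its value on the exterior product of the members of the frame. -/
def densityTriv (e : Splitting i X) :
    Pretrivialization ℝ (TotalSpace.proj : TotalSpace ℝ (Density (i := i) (X := X)) → _) where
  toFun p := (p.1, evalForm p.1 p.2 (wedgeAt e p.1) (wedgeAt e p.1))
  invFun p := ⟨p.1, p.2 • volSqAt e p.1⟩
  source := TotalSpace.proj ⁻¹' (grChart e).source
  target := (grChart e).source ×ˢ univ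
  map_source' p hp := ⟨hp, mem_univ _⟩
  map_target' p hp := hp.1
  left_inv' p hp := by
    change TotalSpace.mk p.1 _ = p
    rw [evalForm_smul_volSqAt hp]
  right_inv' p hp := by
    refine Prod.ext rfl ?_
    simp only [map_smul, Pi.smul_apply, evalForm_volSqAt, volAt_wedgeAt_self hp.1]
    simp
  open_target := (isOpen_grChart_source e).prod isOpen_univ
  baseSet := (grChart e).source
  open_baseSet := isOpen_grChart_source e
  source_eq := rfl
  target_eq := rfl
  proj_toFun _ _ := rfl

instance (e : Splitting i X) : (densityTriv e).IsLinear ℝ where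
  linear V _ := ⟨fun B B' => congr_fun₂ ((evalForm V).map_add B B') _ _,
    fun c B => congr_fun₂ ((evalForm V).map_smul c B) _ _⟩

theorem densityTriv_symm {e : Splitting i X} {V : RealGrassmannian i X}
    (h : V ∈ (grChart e).source) (c : ℝ) : (densityTriv e).symm V c = c • volSqAt e V := by
  rw [Pretrivialization.symm_apply _ h]
  rfl

/-- The transition function from the trivialization of `e` to the trivialization of `e'`. -/
def densityCoord (e e' : Splitting i X) (V : RealGrassmannian i X) : ℝ →L[ℝ] ℝ :=
  (Matrix.det (Matrix.of fun j k => subComp e' e (grChart e' V) (Pi.single k 1) j)) ^ 2 •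
    ContinuousLinearMap.id ℝ ℝ

theorem contMDiffOn_densityCoord (e e' : Splitting i X) :
    ContMDiffOn 𝓘(ℝ, Model i X) 𝓘(ℝ, ℝ →L[ℝ] ℝ) ∞ (densityCoord e e')
      ((grChart e).source ∩ (grChart e').source) := by
  have h1 : ContMDiffOn 𝓘(ℝ, Model i X) 𝓘(ℝ, Model i X) ∞ (grChart e') (grChart e').source :=
    contMDiffOn_of_mem_maximalAtlas
      (IsManifold.subset_maximalAtlas (grHomeo_mem_atlas e'))
  have h2 : ContDiff ℝ ∞ (fun A : Model i X =>
      (Matrix.det (Matrix.of fun j k => subComp e' e A (Pi.single k 1) j)) ^ 2 •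
        ContinuousLinearMap.id ℝ ℝ) := by
    have h3 (j k : Fin i) :
        ContDiff ℝ ∞ (fun A : Model i X => subComp e' e A (Pi.single k (1 : ℝ)) j) := by
      have h4 : ContDiff ℝ ∞ (fun A : Model i X => subComp e' e A (Pi.single k (1 : ℝ))) :=
        (contDiff_subComp e' e).clm_apply contDiff_const
      exact contDiff_pi.1 h4 j
    have h5 : ContDiff ℝ ∞ (fun A : Model i X =>
        Matrix.det (Matrix.of fun j k => subComp e' e A (Pi.single k (1 : ℝ)) j)) := by
      simp only [Matrix.det_apply, Matrix.of_apply, Units.smul_def, zsmul_eq_mul]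
      refine ContDiff.sum fun τ _ => ContDiff.mul contDiff_const ?_
      exact contDiff_prod fun j _ => h3 (τ j) j
    exact (h5.pow 2).smul contDiff_const
  exact (h2.contMDiff.comp_contMDiffOn h1).mono inter_subset_right

theorem densityCoord_apply (e e' : Splitting i X) {V : RealGrassmannian i X}
    (h : V ∈ (grChart e).source ∩ (grChart e').source) (c : ℝ) :
    densityCoord e e' V c = (densityTriv e' ⟨V, (densityTriv e).symm V c⟩).2 := by
  rw [densityTriv_symm h.1]
  change _ = evalForm V (c • volSqAt e V) (wedgeAt e' V) (wedgeAt e' V)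
  rw [map_smul, Pi.smul_apply, Pi.smul_apply, evalForm_volSqAt, volAt_wedgeAt e e' h.2]
  simp only [densityCoord, smul_apply, ContinuousLinearMap.id_apply,
    smul_eq_mul]
  ring

variable (i X) in
/-- The local trivializations that make `L = S²(Λ^i E^*)` a smooth line bundle. -/
def densityPrebundle : VectorPrebundle ℝ ℝ (Density (i := i) (X := X)) where
  pretrivializationAtlas := range densityTriv
  pretrivialization_linear' := by
    rintro _ ⟨e, rfl⟩
    infer_instance
  pretrivializationAt V := densityTriv (splittingAt V)
  mem_base_pretrivializationAt := mem_splittingAt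
  pretrivialization_mem_atlas V := mem_range_self _
  exists_coordChange := by
    rintro _ ⟨e, rfl⟩ _ ⟨e', rfl⟩
    exact ⟨densityCoord e e', (contMDiffOn_densityCoord e e').continuousOn,
      fun V hV c => densityCoord_apply e e' hV c⟩
  totalSpaceMk_isInducing V := by
    have hev (x y : ⋀[ℝ]^i V.1) : Continuous fun B : Density V => evalForm V B x y :=
      (continuous_apply y).comp ((continuous_apply x).comp continuous_induced_dom)
    refine IsInducing.of_comp (g := fun p : RealGrassmannian i X × ℝ =>
      (p.2 • volSqAt (splittingAt V) V : Density V)) ?_ ?_ ?_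
    · exact continuous_const.prodMk
        (hev (wedgeAt (splittingAt V) V) (wedgeAt (splittingAt V) V))
    · exact continuous_snd.smul continuous_const
    · have : ((fun p : RealGrassmannian i X × ℝ => (p.2 • volSqAt (splittingAt V) V : Density V)) ∘
          ((densityTriv (splittingAt V)) ∘ TotalSpace.mk V)) = id :=
        funext fun B => evalForm_smul_volSqAt (mem_splittingAt V) B
      rw [this]
      exact IsInducing.id

instance : (densityPrebundle i X).IsContMDiff 𝓘(ℝ, Model i X) ∞ where
  exists_contMDiffCoordChange := by
    rintro _ ⟨e, rfl⟩ _ ⟨e', rfl⟩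
    exact ⟨densityCoord e e', contMDiffOn_densityCoord e e',
      fun V hV c => densityCoord_apply e e' hV c⟩

instance : TopologicalSpace (TotalSpace ℝ (Density (i := i) (X := X))) :=
  (densityPrebundle i X).totalSpaceTopology

instance : FiberBundle ℝ (Density (i := i) (X := X)) := (densityPrebundle i X).toFiberBundle

instance : VectorBundle ℝ ℝ (Density (i := i) (X := X)) := (densityPrebundle i X).toVectorBundle

instance : ContMDiffVectorBundle ∞ ℝ (Density (i := i) (X := X)) 𝓘(ℝ, Model i X) :=
  (densityPrebundle i X).contMDiffVectorBundle 𝓘(ℝ, Model i X)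

/-- The bilinear form on `Λ^k X` that `b` induces: as a linear map it is `Λ^k b : Λ^k X → Λ^k X^*`,
followed by the identification of `Λ^k X^*` with `(Λ^k X)^*`, hence
`(v₁ ∧ … ∧ v_k, w₁ ∧ … ∧ w_k) ↦ det (b (v_j, w_l))`. -/
def extForm (k : ℕ) (b : LinearMap.BilinForm ℝ X) : LinearMap.BilinForm ℝ (⋀[ℝ]^k X) :=
  (exteriorPower.pairingDual ℝ X k).comp (exteriorPower.map k b)

theorem extForm_ιMulti (k : ℕ) (b : LinearMap.BilinForm ℝ X) (v w : Fin k → X) :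
    extForm k b (exteriorPower.ιMulti ℝ k v) (exteriorPower.ιMulti ℝ k w) =
      Matrix.det (Matrix.of fun j l => b (v j) (w l)) := by
  rw [← Matrix.det_transpose]
  simp only [extForm, LinearMap.comp_apply, exteriorPower.map_apply_ιMulti,
    exteriorPower.pairingDual_ιMulti_ιMulti]
  rfl

theorem extForm_isSymm (k : ℕ) {b : LinearMap.BilinForm ℝ X} (hb : b.IsSymm) :
    (extForm k b).IsSymm := by
  have : extForm k b = (extForm k b).flip := by
    refine exteriorPower.linearMap_ext (AlternatingMap.ext fun v => ?_)
    refine exteriorPower.linearMap_ext (AlternatingMap.ext fun w => ?_)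
    change extForm k b (exteriorPower.ιMulti ℝ k v) (exteriorPower.ιMulti ℝ k w) =
      extForm k b (exteriorPower.ιMulti ℝ k w) (exteriorPower.ιMulti ℝ k v)
    rw [extForm_ιMulti, extForm_ιMulti, ← Matrix.det_transpose]
    congr 1
    ext j l
    exact hb.eq _ _
  exact ⟨fun x y => LinearMap.congr_fun₂ this x y⟩

/-- The section `σ_i` of `L = S²(Λ^i E^*)` defined by a symmetric bilinear form `b` on `X`: its
value in `V` is the restriction to `Λ^i V` of the form that `b` induces on `Λ^i X`. -/
def sectionOf (b : LinearMap.BilinForm ℝ X) (hb : b.IsSymm) (V : RealGrassmannian i X) :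
    Density V :=
  ⟨(extForm i b).compl₁₂ (exteriorPower.map i V.1.subtype) (exteriorPower.map i V.1.subtype),
    ⟨fun _ _ => (extForm_isSymm i hb).eq _ _⟩⟩

end RealGrassmannian

/-! ### The orbits of `SO(p, q)` -/

section Orbits

variable (p q : ℕ)

/-- The space `ℝ^(p+q)`. -/
abbrev PseudoSpace : Type := Fin p ⊕ Fin q → ℝ

/-- The standard symmetric bilinear form of signature `(p, q)` on `ℝ^(p+q)`. -/
def stdForm : LinearMap.BilinForm ℝ (PseudoSpace p q) :=
  Matrix.toBilin' (LieAlgebra.Orthogonal.indefiniteDiagonal (Fin p) (Fin q) ℝ)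

theorem stdForm_isSymm : (stdForm p q).IsSymm := by
  refine ⟨fun v w => ?_⟩
  simp only [stdForm, Matrix.toBilin'_apply', LieAlgebra.Orthogonal.indefiniteDiagonal]
  simp [dotProduct, Matrix.mulVec_diagonal, mul_comm]

/-- The group `SO(p, q)`, as a subgroup of `SL(p+q, ℝ)`. -/
def specialPseudoOrthogonal : Subgroup (Matrix.SpecialLinearGroup (Fin p ⊕ Fin q) ℝ) where
  carrier := {g | ∀ v w, stdForm p q (Matrix.SpecialLinearGroup.toLin' g v)
    (Matrix.SpecialLinearGroup.toLin' g w) = stdForm p q v w}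
  mul_mem' {g h} hg hh v w := by
    rw [map_mul, LinearEquiv.mul_apply, LinearEquiv.mul_apply, hg, hh]
  one_mem' v w := by simp
  inv_mem' {g} hg v w := by
    have key (u : PseudoSpace p q) : Matrix.SpecialLinearGroup.toLin' g
        (Matrix.SpecialLinearGroup.toLin' g⁻¹ u) = u := by
      rw [← LinearEquiv.mul_apply, ← map_mul, mul_inv_cancel, map_one]
      rfl
    rw [← hg, key, key]

/-- The natural action of `SL(p+q, ℝ)` on the Grassmannian. -/
instance (i : ℕ) : MulAction (Matrix.SpecialLinearGroup (Fin p ⊕ Fin q) ℝ)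
    (RealGrassmannian i (PseudoSpace p q)) where
  smul g V := ⟨V.1.map
    (Matrix.SpecialLinearGroup.toLin' g : PseudoSpace p q →ₗ[ℝ] PseudoSpace p q), by
      rw [LinearEquiv.finrank_map_eq, V.2]⟩
  one_smul V := Subtype.ext (by
    change V.1.map _ = V.1
    rw [map_one]
    exact Submodule.map_id _)
  mul_smul g h V := Subtype.ext (by
    change V.1.map _ = (V.1.map _).map _
    rw [← Submodule.map_comp, map_mul]
    rfl)

/-- `O_(r,s)`: the set of those `i`-dimensional subspaces of `ℝ^(p+q)` on which the restriction of
the standard form has signature `(r, s)`. -/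
def signatureStratum (i r s : ℕ) : Set (RealGrassmannian i (PseudoSpace p q)) :=
  {V | sigPos ((stdForm p q).toQuadraticMap.restrict V.1) = r ∧
    sigNeg ((stdForm p q).toQuadraticMap.restrict V.1) = s}

/-- The section `σ_i` of the line bundle `S²(Λ^i E^*)` on `Gr(i, ℝ^(p+q))`. -/
def stdSection (i : ℕ) (V : RealGrassmannian i (PseudoSpace p q)) : RealGrassmannian.Density V :=
  RealGrassmannian.sectionOf (stdForm p q) (stdForm_isSymm p q) V

end Orbits

end

/-! Everything reduces to one function in a chart. If `V` is the graph of `A` in a splitting `e`,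
the trivialization of `L` turns `σ_i(V)` into the Gram determinant `gramDet b e A` of a frame of `V`
(`sectionOf_eq_smul`), which is smooth in `A`.

Zero set: a form of signature `(r, s)` on a space of dimension `r + s + 1` has a one-dimensional
radical, so the determinant vanishes on the stratum. Conversely, both indices can only increase near
a given subspace (`eventually_le_sigPos`). A degenerate subspace close to the stratum therefore has
indices at least `r` and `s` and a radical of dimension at least one, and counting dimensions leaves
only `(r, s)`.

Regularity: let `n` span the radical of `b` on `V`. Since `b` is nondegenerate on the whole space,
some `y` in the complement of `V` has `b n y ≠ 0`. Moving `n` to `n + t y` and fixing the rest of a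
diagonalizing basis gives the Gram determinant `t (2 b n y ∏ w_j + O(t))`, with `w_j = ±1` the other
diagonal entries, so the derivative is nonzero (`fderiv_gramDet_ne_zero`). Hence the stratum is a
regular zero set. By the Leibniz rule every connection differentiates `σ_i` at its zeros as the
determinant is differentiated (`covariantDerivative_sectionOf`).

Orbits: a form of Witt's theorem makes the full isometry group transitive on the stratum. If `V` or
its orthogonal complement contains a non-isotropic vector, the reflection in it stabilizes `V` and
has determinant `-1`, so `SO(p, q)` is transitive as well. Otherwise `V` is a null line in a plane,
as for `p = q = 1`, where the stratum can split. But then the Grassmannian has dimension at most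
one, the stratum consists of isolated points, and each of its subsets is a submanifold too. -/

noncomputable section

set_option linter.unusedSectionVars false

/-! ### Isometries of bilinear forms -/

namespace LinearMap.BilinForm

variable {X : Type*} [AddCommGroup X] [Module ℝ X] {b : LinearMap.BilinForm ℝ X}

/-- A linear automorphism preserves the bilinear form `b`. -/
def Preserves (b : LinearMap.BilinForm ℝ X) (g : X ≃ₗ[ℝ] X) : Prop :=
  ∀ x y, b (g x) (g y) = b x y

theorem Preserves.trans {g h : X ≃ₗ[ℝ] X} (hg : b.Preserves g) (hh : b.Preserves h) :
    b.Preserves (g.trans h) := fun x y => by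
  rw [LinearEquiv.trans_apply, LinearEquiv.trans_apply, hh, hg]

theorem IsSymm.swap (hb : b.IsSymm) (x y : X) : b x y = b y x := by
  simpa using hb.eq x y

/-- The reflection in a vector that is not isotropic. -/
theorem exists_reflection [FiniteDimensional ℝ X] (hb : b.IsSymm) {w : X} (hw : b w w ≠ 0) :
    ∃ g : X ≃ₗ[ℝ] X, b.Preserves g ∧ LinearMap.det (g : X →ₗ[ℝ] X) = -1 ∧
      ∀ x, g x = x - (2 * b w x / b w w) • w := by
  have h : ((2 / b w w) • b w) w = 2 := by simp [hw]
  have happ (x : X) : Module.reflection h x = x - (2 * b w x / b w w) • w := by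
    rw [Module.reflection_apply]
    simp [div_mul_eq_mul_div]
  refine ⟨Module.reflection h, fun x y => ?_, ?_, happ⟩
  · rw [happ, happ]
    simp only [map_sub, map_smul, LinearMap.sub_apply, LinearMap.smul_apply, smul_eq_mul,
      hb.swap x w]
    field_simp
    ring
  -- The map has the form `x + f x • w` with `f w = -2`, and the determinant of such a map is `1 + f
  -- w`.
  · have : (Module.reflection h : X →ₗ[ℝ] X) =
        LinearMap.transvection (-((2 / b w w) • b w)) w := by
      ext x
      simp [happ, LinearMap.transvection.apply, div_mul_eq_mul_div, sub_eq_add_neg]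
    rw [this, LinearMap.transvection.det, LinearMap.neg_apply, h]
    norm_num

/-- The squares of `x - y` and `x + y` add up to `4 b y y ≠ 0`, so one of the two is not isotropic.
The reflection in `x - y` maps `x` to `y`; the one in `x + y` maps `x` to `-y`, which the reflection
in `y` then corrects. All mirror vectors lie in the span of `x` and `y`, whence the last clause,
which makes the induction for Witt's theorem work. -/
theorem exists_preserves_apply_eq [FiniteDimensional ℝ X] (hb : b.IsSymm) {x y : X}
    (hxy : b x x = b y y) (hy : b y y ≠ 0) :
    ∃ g : X ≃ₗ[ℝ] X, b.Preserves g ∧ g x = y ∧ ∀ z, b x z = 0 → b y z = 0 → g z = z := by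
  by_cases h : b (x - y) (x - y) = 0
  · have hs : b (x + y) (x + y) ≠ 0 := by
      simp only [map_sub, map_add, LinearMap.sub_apply, LinearMap.add_apply, hb.swap x y] at h ⊢
      intro h'
      apply hy
      linarith
    have hk : 2 * b (x + y) x / b (x + y) (x + y) = 1 := by
      rw [div_eq_one_iff_eq hs]
      simp only [map_add, LinearMap.add_apply, hb.swap x y, hxy]
      ring
    obtain ⟨g, hg, -, hgx⟩ := exists_reflection hb hs
    obtain ⟨g', hg', -, hgx'⟩ := exists_reflection hb hy
    refine ⟨g.trans g', hg.trans hg', ?_, fun z hxz hyz => ?_⟩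
    · have h1 : g x = -y := by
        rw [hgx, hk]
        module
      rw [LinearEquiv.trans_apply, h1, hgx', map_neg, mul_neg, neg_div, mul_div_assoc,
        div_self hy]
      module
    · rw [LinearEquiv.trans_apply, hgx z, map_add, LinearMap.add_apply, hxz, hyz]
      simp [hgx', hyz]
  · have hk : 2 * b (x - y) x / b (x - y) (x - y) = 1 := by
      rw [div_eq_one_iff_eq h]
      simp only [map_sub, LinearMap.sub_apply, hb.swap x y, hxy]
      ring
    obtain ⟨g, hg, -, hgx⟩ := exists_reflection hb h
    refine ⟨g, hg, ?_, fun z hxz hyz => ?_⟩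
    · rw [hgx, hk]
      module
    · rw [hgx, map_sub, LinearMap.sub_apply, hxz, hyz]
      simp

/-- **Witt's theorem** for orthogonal families of vectors that are not isotropic. -/
theorem exists_preserves_forall_apply_eq [FiniteDimensional ℝ X] (hb : b.IsSymm) {ι : Type*}
    [Finite ι] {v v' : ι → X} (hv : Pairwise fun j k => b (v j) (v k) = 0)
    (hv' : Pairwise fun j k => b (v' j) (v' k) = 0) (h : ∀ j, b (v j) (v j) = b (v' j) (v' j))
    (h0 : ∀ j, b (v' j) (v' j) ≠ 0) :
    ∃ g : X ≃ₗ[ℝ] X, b.Preserves g ∧ ∀ j, g (v j) = v' j := by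
  classical
  have := Fintype.ofFinite ι
  suffices ∀ s : Finset ι, ∃ g : X ≃ₗ[ℝ] X, b.Preserves g ∧ ∀ j ∈ s, g (v j) = v' j by
    simpa using this Finset.univ
  intro s
  induction s using Finset.induction_on with
  | empty => exact ⟨LinearEquiv.refl ℝ X, fun _ _ => rfl, by simp⟩
  | insert a s has ih =>
    obtain ⟨g, hg, hgs⟩ := ih
    -- The vectors already placed are orthogonal both to `g (v a)` and to `v' a`, so the correction
    -- `g'` leaves them fixed.
    obtain ⟨g', hg', hga, hfix⟩ := exists_preserves_apply_eq hb (x := g (v a)) (y := v' a)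
      (by rw [hg, h]) (h0 a)
    refine ⟨g.trans g', hg.trans hg', fun j hj => ?_⟩
    rw [LinearEquiv.trans_apply]
    rcases Finset.mem_insert.1 hj with rfl | hj
    · exact hga
    · have hne : a ≠ j := fun h => has (h ▸ hj)
      rw [hfix, hgs j hj]
      · rw [hg, hv hne]
      · rw [hgs j hj, hv' hne]

/-! ### Diagonalizing bases and their signs -/

/-- A basis of `V` which diagonalizes the restriction of `b` to `V`. -/
structure IsSignBasis (b : LinearMap.BilinForm ℝ X) (V : Submodule ℝ X) {i : ℕ}
    (v : Fin i → X) (w : Fin i → SignType) : Prop where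
  span_eq : Submodule.span ℝ (Set.range v) = V
  apply_self : ∀ j, b (v j) (v j) = w j
  apply_ne : Pairwise fun j k => b (v j) (v k) = 0

/-- Sylvester's law of inertia: an isometry onto a weighted sum of squares with weights in `{-1, 0,
1}` carries the standard basis back to `V`, and the indices count the weights. -/
theorem exists_isSignBasis (hb : b.IsSymm) (V : Submodule ℝ X) [FiniteDimensional ℝ V] {i : ℕ}
    (hV : Module.finrank ℝ V = i) :
    ∃ (v : Fin i → X) (w : Fin i → SignType), b.IsSignBasis V v w ∧
      sigPos (b.toQuadraticMap.restrict V) = Fintype.card {j // w j = 1} ∧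
      sigNeg (b.toQuadraticMap.restrict V) = Fintype.card {j // w j = -1} := by
  subst hV
  obtain ⟨w, hw⟩ := QuadraticForm.equivalent_signType_weighted_sum_squared
    (b.toQuadraticMap.restrict V)
  have hpos := QuadraticForm.sigPos_of_equiv_weightedSumSquares hw
  have hneg := QuadraticForm.sigNeg_of_equiv_weightedSumSquares hw
  obtain ⟨e⟩ := hw
  let v : Fin (Module.finrank ℝ V) → V := fun j => e.symm (Pi.single j 1)
  have hQ (x : Fin (Module.finrank ℝ V) → ℝ) :
      b (e.symm x) (e.symm x) = ∑ j, (w j : ℝ) * (x j * x j) := by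
    have := e.symm.map_app x
    rw [QuadraticMap.weightedSumSquares_apply] at this
    exact this
  refine ⟨fun j => v j, w, ⟨?_, fun j => ?_, fun j k hjk => ?_⟩, ?_, ?_⟩
  · have h1 : Submodule.span ℝ (Set.range v) = ⊤ := by
      have : Set.range v = e.symm.toLinearEquiv.toLinearMap '' Set.range (Pi.basisFun ℝ (Fin (Module.finrank ℝ V))) := by
        rw [← Set.range_comp]
        congr 1
        ext j
        simp [v]
      rw [this, Submodule.span_image, Module.Basis.span_eq, Submodule.map_top,
        LinearEquiv.range]
    have h2 : Set.range (fun j => (v j : X)) = V.subtype '' Set.range v := by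
      rw [← Set.range_comp]; rfl
    rw [h2, Submodule.span_image, h1, Submodule.map_top, Submodule.range_subtype]
  · rw [hQ]
    simp [Pi.single_apply]
  -- Orthogonality by polarization: the square of the sum is the sum of the squares.
  · have h1 := hQ (Pi.single j 1 + Pi.single k 1)
    have h2 := hQ (Pi.single j 1)
    have h3 := hQ (Pi.single k 1)
    have h4 : e.symm (Pi.single j 1 + Pi.single k 1) = v j + v k := map_add e.symm.toLinearEquiv _ _
    have h5 : ∑ l, (w l : ℝ) * ((Pi.single j 1 + Pi.single k 1 : Fin _ → ℝ) l *
        (Pi.single j 1 + Pi.single k 1 : Fin _ → ℝ) l) =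
        ∑ l, (w l : ℝ) * ((Pi.single j 1 : Fin _ → ℝ) l * (Pi.single j 1 : Fin _ → ℝ) l) +
        ∑ l, (w l : ℝ) * ((Pi.single k 1 : Fin _ → ℝ) l * (Pi.single k 1 : Fin _ → ℝ) l) := by
      rw [← Finset.sum_add_distrib]
      refine Finset.sum_congr rfl fun l _ => ?_
      have : (Pi.single j 1 : Fin _ → ℝ) l * (Pi.single k 1 : Fin _ → ℝ) l = 0 := by
        simp only [Pi.single_apply]
        split_ifs with h h' <;> simp_all
      simp only [Pi.add_apply]
      linear_combination 2 * (w l : ℝ) * this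
    rw [h5, ← h2, ← h3, h4] at h1
    change b (v j + v k : X) (v j + v k : X) = b (v j) (v j) + b (v k) (v k) at h1
    simp only [map_add, LinearMap.add_apply, hb.swap (v k : X) (v j)] at h1
    linarith
  · rw [hpos, ← Nat.card_eq_fintype_card, ← Nat.card_coe_set_eq]
    congr! 3 with j
    cases h : w j <;> simp [h]
  · rw [hneg, ← Nat.card_eq_fintype_card, ← Nat.card_coe_set_eq]
    congr! 3 with j
    cases h : w j <;> simp [h]

theorem IsSignBasis.linearIndependent {V : Submodule ℝ X} {i : ℕ} {v : Fin i → X}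
    {w : Fin i → SignType} (h : b.IsSignBasis V v w) (hV : Module.finrank ℝ V = i) :
    LinearIndependent ℝ v := by
  rw [linearIndependent_iff_card_eq_finrank_span, Set.finrank, h.span_eq, hV, Fintype.card_fin]

theorem card_signType_fibers {i : ℕ} (w : Fin i → SignType) :
    Fintype.card {j // w j = 0} + Fintype.card {j // w j = 1} + Fintype.card {j // w j = -1} = i := by
  have h := Finset.card_eq_sum_card_fiberwise (f := w) (s := Finset.univ) (t := {0, 1, -1})
    (fun j _ => by cases h : w j <;> simp)
  rw [Finset.card_univ, Fintype.card_fin, Finset.sum_insert (by decide),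
    Finset.sum_insert (by decide), Finset.sum_singleton] at h
  simp only [Fintype.card_subtype]
  omega

/-- If `V` has signature `(r, s)` and dimension `r + s + 1`, exactly one vector of a diagonalizing
basis is isotropic. -/
theorem exists_eq_zero_iff {r s i : ℕ} (hrs : r + s + 1 = i) {w : Fin i → SignType}
    (hr : Fintype.card {j // w j = 1} = r) (hs : Fintype.card {j // w j = -1} = s) :
    Fintype.card {j // w j = 0} = 1 ∧ ∃ j₀, ∀ j, w j = 0 ↔ j = j₀ := by
  have h1 := card_signType_fibers w
  have h2 : Fintype.card {j // w j = 0} = 1 := by omega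
  refine ⟨h2, ?_⟩
  obtain ⟨⟨j₀, hj₀⟩, h⟩ := Fintype.card_eq_one_iff.1 h2
  exact ⟨j₀, fun j => ⟨fun hj => congrArg Subtype.val (h ⟨j, hj⟩), fun hj => hj ▸ hj₀⟩⟩

/-! ### Transitivity of the isometries on a stratum -/

/-- An isotropic vector that forms a hyperbolic pair with the isotropic member of an orthogonal
family and is orthogonal to the other members. -/
theorem exists_hyperbolic_partner (hb : b.IsSymm) (hnd : b.Nondegenerate) {ι : Type*}
    [Finite ι] {v : ι → X} {j₀ : ι} (hv : Pairwise fun j k => b (v j) (v k) = 0)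
    (h0 : ∀ j, b (v j) (v j) = 0 ↔ j = j₀) (hn : v j₀ ≠ 0) :
    ∃ m, b m m = 0 ∧ b (v j₀) m = 1 ∧ ∀ j, j ≠ j₀ → b (v j) m = 0 := by
  classical
  have := Fintype.ofFinite ι
  obtain ⟨x, hx⟩ : ∃ x, b (v j₀) x ≠ 0 := by
    by_contra! h
    exact hn (hnd.1 _ h)
  -- Subtract from `x` its projections to the non-isotropic members; this does not change the
  -- pairing with `v j₀`.
  let y := x - ∑ k ∈ Finset.univ.erase j₀, (b (v k) x / b (v k) (v k)) • v k
  have hy (j : ι) (hj : j ≠ j₀) : b (v j) y = 0 := by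
    simp only [y, map_sub, map_sum, map_smul, smul_eq_mul]
    rw [Finset.sum_eq_single_of_mem j (by simpa using hj)
      (fun k _ hkj => by rw [hv hkj.symm, mul_zero]), div_mul_cancel₀, sub_self]
    exact fun h => hj ((h0 j).1 h)
  have hy0 : b (v j₀) y = b (v j₀) x := by
    simp only [y, map_sub, map_sum, map_smul, smul_eq_mul]
    rw [Finset.sum_eq_zero, sub_zero]
    intro k hk
    rw [hv (Finset.ne_of_mem_erase hk).symm, mul_zero]
  let c := b (v j₀) x
  -- The factor `c⁻¹` normalizes the pairing with `v j₀`, and the multiple of the null vector `v j₀`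
  -- is chosen to cancel the square of `c⁻¹ • y`.
  refine ⟨c⁻¹ • y - (b y y / (2 * c ^ 2)) • v j₀, ?_, ?_, fun j hj => ?_⟩
  · simp only [map_sub, map_smul, LinearMap.sub_apply, LinearMap.smul_apply, smul_eq_mul,
      hb.swap y (v j₀), (h0 j₀).2 rfl, hy0]
    change c⁻¹ * (c⁻¹ * b y y - b y y / (2 * c ^ 2) * c) -
      b y y / (2 * c ^ 2) * (c⁻¹ * c - b y y / (2 * c ^ 2) * 0) = 0
    have : c ≠ 0 := hx
    field_simp
    ring
  · simp only [map_sub, map_smul, smul_eq_mul, (h0 j₀).2 rfl, hy0, mul_zero, sub_zero]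
    exact inv_mul_cancel₀ hx
  · simp only [map_sub, map_smul, smul_eq_mul, hy j hj, hv hj, mul_zero, sub_zero]

/-- The isometries act transitively on the subspaces of a given signature `(r, s)` that have
dimension `r + s + 1`. -/
theorem exists_preserves_map_eq [FiniteDimensional ℝ X] (hb : b.IsSymm)
    (hnd : b.Nondegenerate) {r s i : ℕ} (hrs : r + s + 1 = i) {V V' : Submodule ℝ X}
    (hV : Module.finrank ℝ V = i) (hV' : Module.finrank ℝ V' = i)
    (hr : sigPos (b.toQuadraticMap.restrict V) = r) (hs : sigNeg (b.toQuadraticMap.restrict V) = s)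
    (hr' : sigPos (b.toQuadraticMap.restrict V') = r)
    (hs' : sigNeg (b.toQuadraticMap.restrict V') = s) :
    ∃ g : X ≃ₗ[ℝ] X, b.Preserves g ∧ V.map (g : X →ₗ[ℝ] X) = V' := by
  classical
  obtain ⟨v, w, hv, hvr, hvs⟩ := exists_isSignBasis hb V hV
  obtain ⟨u, z, hu, hur, hus⟩ := exists_isSignBasis hb V' hV'
  rw [hr] at hvr; rw [hs] at hvs; rw [hr'] at hur; rw [hs'] at hus
  obtain ⟨hw0, j₀, hj₀⟩ := exists_eq_zero_iff hrs hvr.symm hvs.symm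
  obtain ⟨hz0, k₀, hk₀⟩ := exists_eq_zero_iff hrs hur.symm hus.symm
  have hcard (c : SignType) : Fintype.card {j // w j = c} = Fintype.card {j // z j = c} := by
    cases c
    · exact hw0.trans hz0.symm
    · exact hvs.symm.trans hus
    · exact hvr.symm.trans hur
  -- The two bases have equally many vectors of each sign; `τ` matches vectors of equal square.
  let τ : Fin i ≃ Fin i := Equiv.ofFiberEquiv fun c => Fintype.equivOfCardEq (hcard c)
  have hτ (j : Fin i) : z (τ j) = w j := Equiv.ofFiberEquiv_map _ j
  have hτ0 : τ j₀ = k₀ := by rw [← hk₀, hτ, hj₀]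
  have hτne {j : Fin i} (hj : j ≠ j₀) : τ j ≠ k₀ := by
    rwa [← hτ0, τ.injective.ne_iff]
  have hiso {v : Fin i → X} {w : Fin i → SignType} {V : Submodule ℝ X} {j₀ : Fin i}
      (hv : b.IsSignBasis V v w) (hj₀ : ∀ j, w j = 0 ↔ j = j₀) (j : Fin i) :
      b (v j) (v j) = 0 ↔ j = j₀ := by
    rw [hv.apply_self, ← hj₀]
    cases w j <;> simp
  obtain ⟨m, hm, hm1, hm0⟩ := exists_hyperbolic_partner hb hnd hv.apply_ne (hiso hv hj₀)
    ((hv.linearIndependent hV).ne_zero j₀)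
  obtain ⟨m', hm', hm1', hm0'⟩ := exists_hyperbolic_partner hb hnd hu.apply_ne (hiso hu hk₀)
    ((hu.linearIndependent hV').ne_zero k₀)
  -- Witt's theorem is available only for non-isotropic vectors, so the null vector `v j₀` is
  -- replaced by `v j₀ + m` and `v j₀ - m`, of squares `2` and `-2`. The extra index `none` holds
  -- the difference.
  let f (v : Fin i → X) (j₀ : Fin i) (m : X) : Option (Fin i) → X := fun o =>
    o.elim (v j₀ - m) fun j => if j = j₀ then v j₀ + m else v j
  have key {v : Fin i → X} {w : Fin i → SignType} {V : Submodule ℝ X} {j₀ : Fin i} {m : X}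
      (hv : b.IsSignBasis V v w) (hj₀ : ∀ j, w j = 0 ↔ j = j₀) (hm : b m m = 0)
      (hm1 : b (v j₀) m = 1) (hm0 : ∀ j, j ≠ j₀ → b (v j) m = 0) :
      (Pairwise fun o o' => b (f v j₀ m o) (f v j₀ m o') = 0) ∧
      ∀ o, b (f v j₀ m o) (f v j₀ m o) = o.elim (-2) fun j => if j = j₀ then 2 else (w j : ℝ) := by
    have h00 := (hiso hv hj₀ j₀).2 rfl
    have hm1' := hm1
    rw [hb.swap] at hm1'
    have hm0' (j) (hj : j ≠ j₀) : b m (v j) = 0 := by rw [hb.swap, hm0 j hj]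
    constructor
    · rintro (_ | j) (_ | k) hjk
      · exact absurd rfl hjk
      · by_cases hk : k = j₀
        · simp [f, hk, h00, hm, hm1, hm1']
        · simp [f, hk, hm0' k hk, hv.apply_ne (Ne.symm hk)]
      · by_cases hj : j = j₀
        · simp [f, hj, h00, hm, hm1, hm1']
        · simp [f, hj, hm0 j hj, hv.apply_ne hj]
      · have hjk' : j ≠ k := fun h => hjk (by rw [h])
        by_cases hj : j = j₀
        · subst hj
          simp [f, hjk'.symm, hv.apply_ne hjk', hm0' k hjk'.symm]
        · by_cases hk : k = j₀
          · subst hk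
            simp [f, hjk', hv.apply_ne hjk', hm0 j hjk']
          · simp [f, hj, hk, hv.apply_ne hjk']
    · rintro (_ | j)
      · simp [f, h00, hm, hm1, hm1']
        norm_num
      · by_cases hj : j = j₀
        · simp [f, hj, h00, hm, hm1, hm1']
          norm_num
        · simp [f, hj, hv.apply_self]
  obtain ⟨hf, hf'⟩ := key hv hj₀ hm hm1 hm0
  obtain ⟨hg, hg'⟩ := key hu hk₀ hm' hm1' hm0'
  let ρ : Option (Fin i) ≃ Option (Fin i) := Equiv.optionCongr τ
  have hval (o : Option (Fin i)) :
      b (f v j₀ m o) (f v j₀ m o) = b (f u k₀ m' (ρ o)) (f u k₀ m' (ρ o)) := by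
    rw [hf', hg']
    rcases o with _ | j
    · simp [ρ]
    · by_cases hj : j = j₀
      · simp [ρ, hj, hτ0]
      · simp [ρ, hj, hτne hj, hτ]
  obtain ⟨g, hgb, hgf⟩ := exists_preserves_forall_apply_eq hb hf
    (fun o o' h => hg (ρ.injective.ne h)) hval (fun o => by
      rw [← hval, hf']
      rcases o with _ | j
      · simp
      · by_cases hj : j = j₀
        · simp [hj]
        · have : w j ≠ 0 := fun h => hj ((hj₀ j).1 h)
          simp only [Option.elim_some, if_neg hj]
          revert this
          cases w j <;> simp)
  have hgv (j : Fin i) : g (v j) = u (τ j) := by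
    by_cases hj : j = j₀
    · have h1 := hgf none
      have h2 := hgf (some j₀)
      simp only [f, ρ, Equiv.optionCongr_apply, Option.map_none, Option.map_some, Option.elim_none,
        Option.elim_some, hτ0, if_true, map_add, map_sub] at h1 h2
      -- Adding the images of the sum and the difference recovers the image of the null vector.
      have h3 : (2 : ℝ) • g (v j₀) = (2 : ℝ) • u k₀ := by
        calc (2 : ℝ) • g (v j₀) = (g (v j₀) - g m) + (g (v j₀) + g m) := by module
          _ = (2 : ℝ) • u k₀ := by rw [h1, h2]; module
      rw [hj, hτ0]
      exact smul_right_injective X two_ne_zero h3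
    · have := hgf (some j)
      simpa [f, ρ, hj, hτne hj] using this
  refine ⟨g, hgb, ?_⟩
  rw [← hv.span_eq, ← hu.span_eq, ← Submodule.span_image, ← Set.range_comp,
    ← τ.surjective.range_comp u]
  congr 2
  ext j
  exact hgv j

/-- Take determinants in `gᵀ B g = B`, where `B` is the invertible Gram matrix of a basis. -/
theorem Preserves.det_eq {g : X ≃ₗ[ℝ] X} [FiniteDimensional ℝ X] (hg : b.Preserves g)
    (hnd : b.Nondegenerate) :
    LinearMap.det (g : X →ₗ[ℝ] X) = 1 ∨ LinearMap.det (g : X →ₗ[ℝ] X) = -1 := by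
  let B := Module.finBasis ℝ X
  have h1 : (LinearMap.toMatrix B B g).transpose * LinearMap.BilinForm.toMatrix B b *
      LinearMap.toMatrix B B g = LinearMap.BilinForm.toMatrix B b := by
    rw [← LinearMap.BilinForm.toMatrix_comp]
    congr 1
    ext x y
    exact hg x y
  have h2 := (LinearMap.BilinForm.nondegenerate_iff_det_ne_zero B).1 hnd
  have h3 := congrArg Matrix.det h1
  rw [Matrix.det_mul, Matrix.det_mul, Matrix.det_transpose, LinearMap.det_toMatrix] at h3
  rw [← sq_eq_one_iff]
  apply mul_right_cancel₀ h2
  linear_combination h3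

end LinearMap.BilinForm

/-! ### Isometries of determinant one and the exceptional case -/

namespace LinearMap.BilinForm

variable {X : Type*} [AddCommGroup X] [Module ℝ X] {b : LinearMap.BilinForm ℝ X}

/-- The reflection in `w` changes vectors by multiples of `w`: this stays in `V` if `w` does, and is
the identity on `V` if `w` is orthogonal to `V`. -/
theorem exists_preserves_det_eq_neg_one_map_eq [FiniteDimensional ℝ X] (hb : b.IsSymm)
    {V : Submodule ℝ X} {w : X} (hw : b w w ≠ 0) (hwV : w ∈ V ∨ ∀ x ∈ V, b w x = 0) :
    ∃ g : X ≃ₗ[ℝ] X, b.Preserves g ∧ LinearMap.det (g : X →ₗ[ℝ] X) = -1 ∧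
      V.map (g : X →ₗ[ℝ] X) = V := by
  obtain ⟨g, hg, hdet, hgx⟩ := exists_reflection hb hw
  refine ⟨g, hg, hdet, ?_⟩
  refine Submodule.eq_of_le_of_finrank_eq ?_ (LinearEquiv.finrank_map_eq g V)
  rintro _ ⟨x, hx, rfl⟩
  rw [LinearEquiv.coe_coe, hgx]
  rcases hwV with hwV | hwV
  · exact V.sub_mem hx (V.smul_mem _ hwV)
  · simpa [hwV x hx] using hx

/-- An isometry of determinant `-1` between the subspaces is precomposed with a reflection that
stabilizes `V`. -/
theorem exists_preserves_det_eq_one_map_eq [FiniteDimensional ℝ X] (hb : b.IsSymm)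
    (hnd : b.Nondegenerate) {r s i : ℕ} (hrs : r + s + 1 = i) {V V' : Submodule ℝ X}
    (hV : Module.finrank ℝ V = i) (hV' : Module.finrank ℝ V' = i)
    (hr : sigPos (b.toQuadraticMap.restrict V) = r) (hs : sigNeg (b.toQuadraticMap.restrict V) = s)
    (hr' : sigPos (b.toQuadraticMap.restrict V') = r)
    (hs' : sigNeg (b.toQuadraticMap.restrict V') = s)
    {w : X} (hw : b w w ≠ 0) (hwV : w ∈ V ∨ ∀ x ∈ V, b w x = 0) :
    ∃ g : X ≃ₗ[ℝ] X, b.Preserves g ∧ LinearMap.det (g : X →ₗ[ℝ] X) = 1 ∧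
      V.map (g : X →ₗ[ℝ] X) = V' := by
  obtain ⟨g, hg, hgV⟩ := exists_preserves_map_eq hb hnd hrs hV hV' hr hs hr' hs'
  rcases hg.det_eq hnd with h | h
  · exact ⟨g, hg, h, hgV⟩
  · obtain ⟨g', hg', hdet, hgV'⟩ := exists_preserves_det_eq_neg_one_map_eq hb hw hwV
    refine ⟨g'.trans g, hg'.trans hg, ?_, ?_⟩
    · rw [LinearEquiv.coe_trans, LinearMap.det_comp, h, hdet]
      norm_num
    · rw [LinearEquiv.coe_trans, Submodule.map_comp, hgV', hgV]

/-- If neither `V` nor its orthogonal complement contains vectors that are not isotropic, then `V`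
is a null line in a space of dimension at most two. -/
theorem finrank_le_of_forall_isotropic [FiniteDimensional ℝ X] (hb : b.IsSymm)
    (hnd : b.Nondegenerate) {r s i : ℕ} (hrs : r + s + 1 = i) {V : Submodule ℝ X}
    (hV : Module.finrank ℝ V = i)
    (hr : sigPos (b.toQuadraticMap.restrict V) = r) (hs : sigNeg (b.toQuadraticMap.restrict V) = s)
    (h : ∀ w, (w ∈ V ∨ ∀ x ∈ V, b w x = 0) → b w w = 0) :
    i = 1 ∧ Module.finrank ℝ X ≤ 2 := by
  obtain ⟨v, w, hv, hvr, hvs⟩ := exists_isSignBasis hb V hV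
  rw [hr] at hvr; rw [hs] at hvs
  obtain ⟨hw0, -⟩ := exists_eq_zero_iff hrs hvr.symm hvs.symm
  have hi : i = 1 := by
    -- The basis vectors lie in `V`, so all weights are zero; but exactly one of them is.
    rw [← hw0, Fintype.card_subtype, Finset.filter_true_of_mem, Finset.card_univ, Fintype.card_fin]
    intro j _
    have := hv.apply_self j
    rw [h (v j) (Or.inl (hv.span_eq ▸ Submodule.subset_span (Set.mem_range_self j)))] at this
    revert this
    cases w j <;> simp
  refine ⟨hi, ?_⟩
  have h1 := LinearMap.BilinForm.finrank_orthogonal hnd V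
  have h2 := LinearMap.BilinForm.finrank_orthogonal hnd (b.orthogonal V)
  have hK (x : X) (hx : x ∈ b.orthogonal V) : b x x = 0 :=
    h x (Or.inr fun y hy => by rw [hb.swap]; exact hx y hy)
  -- By polarization the complement is totally isotropic, so its dimension `n - 1` is at most that
  -- of its own complement, which is `1`.
  have h3 : b.orthogonal V ≤ b.orthogonal (b.orthogonal V) := by
    intro x hx y hy
    have := hK _ (add_mem hx hy)
    simp only [map_add, LinearMap.add_apply, hK x hx, hK y hy, hb.swap x y] at this
    change b y x = 0
    linarith
  have h4 := Submodule.finrank_mono h3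
  omega

/-- The linear isometries preserve the restrictions of `b` to subspaces. -/
theorem Preserves.equivalent_restrict {g : X ≃ₗ[ℝ] X} (hg : b.Preserves g) (V : Submodule ℝ X) :
    (b.toQuadraticMap.restrict V).Equivalent
      (b.toQuadraticMap.restrict (V.map (g : X →ₗ[ℝ] X))) :=
  ⟨⟨g.submoduleMap V, fun x => hg x x⟩⟩

end LinearMap.BilinForm

/-! ### The orbits in the strata -/

section Orbits

open LinearMap.BilinForm

variable {p q i r s : ℕ}

theorem stdForm_nondegenerate (p q : ℕ) : (stdForm p q).Nondegenerate := by
  refine LinearMap.BilinForm.nondegenerate_toBilin'_of_det_ne_zero' _ ?_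
  rw [LieAlgebra.Orthogonal.indefiniteDiagonal, Matrix.det_diagonal]
  refine Finset.prod_ne_zero_iff.2 fun j _ => ?_
  rcases j with j | j <;> simp

theorem orbit_subset_signatureStratum {V : RealGrassmannian i (PseudoSpace p q)}
    (hV : V ∈ signatureStratum p q i r s) :
    MulAction.orbit (specialPseudoOrthogonal p q) V ⊆ signatureStratum p q i r s := by
  rintro _ ⟨g, rfl⟩
  have hg : (stdForm p q).Preserves (Matrix.SpecialLinearGroup.toLin' g.1) := g.2
  have := hg.equivalent_restrict V.1
  exact ⟨this.sigPos_eq.symm.trans hV.1, this.sigNeg_eq.symm.trans hV.2⟩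

theorem mem_orbit_of_preserves {V V' : RealGrassmannian i (PseudoSpace p q)}
    {g : PseudoSpace p q ≃ₗ[ℝ] PseudoSpace p q} (hg : (stdForm p q).Preserves g)
    (hdet : LinearMap.det (g : PseudoSpace p q →ₗ[ℝ] PseudoSpace p q) = 1)
    (hV : V.1.map (g : PseudoSpace p q →ₗ[ℝ] PseudoSpace p q) = V'.1) :
    V' ∈ MulAction.orbit (specialPseudoOrthogonal p q) V := by
  let A : Matrix.SpecialLinearGroup (Fin p ⊕ Fin q) ℝ :=
    ⟨LinearMap.toMatrix' (g : PseudoSpace p q →ₗ[ℝ] PseudoSpace p q), by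
      rw [LinearMap.det_toMatrix', hdet]⟩
  have hA : Matrix.SpecialLinearGroup.toLin' A = g := by
    ext1 x
    rw [Matrix.SpecialLinearGroup.toLin'_apply]
    simp [A]
  refine ⟨⟨A, fun x y => ?_⟩, Subtype.ext ?_⟩
  · rw [hA]
    exact hg x y
  · change V.1.map (Matrix.SpecialLinearGroup.toLin' A :
      PseudoSpace p q →ₗ[ℝ] PseudoSpace p q) = V'.1
    rw [hA, hV]

/-- An orbit in a stratum is the whole stratum, unless the stratum consists of null lines in a
plane. -/
theorem orbit_eq_signatureStratum_or (hrs : r + s + 1 = i)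
    {V : RealGrassmannian i (PseudoSpace p q)} (hV : V ∈ signatureStratum p q i r s) :
    MulAction.orbit (specialPseudoOrthogonal p q) V = signatureStratum p q i r s ∨
      (i = 1 ∧ Module.finrank ℝ (PseudoSpace p q) ≤ 2) := by
  by_cases h : ∀ w, (w ∈ V.1 ∨ ∀ x ∈ V.1, stdForm p q w x = 0) → stdForm p q w w = 0
  · exact Or.inr (finrank_le_of_forall_isotropic (stdForm_isSymm p q) (stdForm_nondegenerate p q)
      hrs V.2 hV.1 hV.2 h)
  · push Not at h
    obtain ⟨w, hwV, hw⟩ := h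
    refine Or.inl ((orbit_subset_signatureStratum hV).antisymm fun V' hV' => ?_)
    obtain ⟨g, hg, hdet, hgV⟩ := exists_preserves_det_eq_one_map_eq (stdForm_isSymm p q)
      (stdForm_nondegenerate p q) hrs V.2 V'.2 hV.1 hV.2 hV'.1 hV'.2 hw hwV
    exact mem_orbit_of_preserves hg hdet hgV

/-- In a manifold of dimension at most one, the submanifolds of codimension one consist of isolated
points. -/
theorem IsEmbeddedSubmanifold.mono_of_finrank_le_one {E : Type*} [NormedAddCommGroup E]
    [NormedSpace ℝ E] [FiniteDimensional ℝ E] {M : Type*} [TopologicalSpace M] [ChartedSpace E M]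
    (hE : Module.finrank ℝ E ≤ 1) {N N' : Set M} (hN : IsEmbeddedSubmanifold (E := E) N 1)
    (h : N' ⊆ N) : IsEmbeddedSubmanifold (E := E) N' 1 := by
  intro x hx
  obtain ⟨φ, hφ, hxφ, W, hW, hWc, hNW⟩ := hN x (h hx)
  refine ⟨φ, hφ, hxφ, W, hW, hWc, subset_antisymm ?_ ?_⟩
  · exact fun y hy => hNW.subset ⟨h hy.1, hy.2⟩
  -- Codimension one in dimension at most one leaves only the zero subspace, so the chart domain
  -- contains a single point of `N`.
  · have hbot : W = ⊥ := by
      have := W.finrank_quotient_add_finrank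
      rw [← Submodule.finrank_eq_zero (R := ℝ)]
      omega
    have hx0 : φ x ∈ W := (hNW.subset ⟨h hx, hxφ⟩).2
    rintro y ⟨hy, hyW⟩
    have hy0 : φ y ∈ W := hyW
    rw [hbot, Submodule.mem_bot] at hx0 hy0
    have : y = x := φ.injOn hy hxφ (hy0.trans hx0.symm)
    exact this ▸ ⟨hx, hxφ⟩

theorem finrank_model_le_one {X : Type*} [NormedAddCommGroup X] [NormedSpace ℝ X]
    [FiniteDimensional ℝ X] (hi : i = 1) (hX : Module.finrank ℝ X ≤ 2) :
    Module.finrank ℝ (RealGrassmannian.Model i X) ≤ 1 := by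
  rw [← (LinearMap.toContinuousLinearMap (𝕜 := ℝ) (E := RealGrassmannian.Sub i)
    (F' := RealGrassmannian.Quo i X)).finrank_eq, Module.finrank_linearMap]
  simp only [Module.finrank_fintype_fun_eq_card, Fintype.card_fin, hi]
  omega

/-- In the exceptional case only the submanifold property needs an argument, which the dimension
bound supplies; the conditions on the section pass to subsets. -/
theorem isDefiningSection_orbit (hrs : r + s + 1 = i)
    (h : IsDefiningSection (RealGrassmannian.Model i (PseudoSpace p q)) ℝ (stdSection p q i)
      (signatureStratum p q i r s))
    {V : RealGrassmannian i (PseudoSpace p q)} (hV : V ∈ signatureStratum p q i r s) :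
    IsDefiningSection (RealGrassmannian.Model i (PseudoSpace p q)) ℝ (stdSection p q i)
      (MulAction.orbit (specialPseudoOrthogonal p q) V) := by
  rcases orbit_eq_signatureStratum_or hrs hV with heq | ⟨hi, hX⟩
  · rwa [heq]
  · have hsub := orbit_subset_signatureStratum hV
    refine ⟨?_, h.contMDiff, fun y hy => h.eq_zero y (hsub hy),
      fun cov y hy => h.surjective cov y (hsub hy)⟩
    have hN := h.isEmbeddedSubmanifold
    rw [Module.finrank_self] at hN ⊢
    exact hN.mono_of_finrank_le_one (finrank_model_le_one hi hX) hsub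

end Orbits

/-! ### The Gram determinant in a chart: zeros and derivative -/

theorem contDiff_matrix_det {E ι : Type*} [NormedAddCommGroup E] [NormedSpace ℝ E] [Fintype ι]
    [DecidableEq ι] {n : ℕ∞ω} {M : E → Matrix ι ι ℝ} (hM : ∀ j k, ContDiff ℝ n fun x => M x j k) :
    ContDiff ℝ n fun x => (M x).det := by
  simp only [Matrix.det_apply, Units.smul_def, zsmul_eq_mul]
  exact ContDiff.sum fun τ _ => contDiff_const.mul (contDiff_prod fun j _ => hM (τ j) j)

theorem LinearMap.BilinForm.contDiff_apply {E X : Type*} [NormedAddCommGroup E] [NormedSpace ℝ E]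
    [NormedAddCommGroup X] [NormedSpace ℝ X] [FiniteDimensional ℝ X] (b : LinearMap.BilinForm ℝ X)
    {n : ℕ∞ω} {f g : E → X} (hf : ContDiff ℝ n f) (hg : ContDiff ℝ n g) :
    ContDiff ℝ n fun x => b (f x) (g x) := by
  let c : X →L[ℝ] X →L[ℝ] ℝ :=
    LinearMap.toContinuousLinearMap ((LinearMap.toContinuousLinearMap (E := X) (F' := ℝ)).toLinearMap ∘ₗ b)
  exact (c.contDiff.comp hf).clm_apply hg

/-- Cramer's rule with the adjugate of a diagonal matrix. It evaluates the derivative of the Gram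
determinant at a degenerate diagonal Gram matrix. -/
theorem Matrix.det_updateRow_diagonal {ι : Type*} [Fintype ι] [DecidableEq ι] (w h : ι → ℝ)
    (j₀ : ι) : ((Matrix.diagonal w).updateRow j₀ h).det =
      (∏ j ∈ Finset.univ.erase j₀, w j) * h j₀ := by
  rw [← Matrix.cramer_transpose_apply, Matrix.diagonal_transpose, Matrix.cramer_eq_adjugate_mulVec,
    Matrix.adjugate_diagonal, Matrix.mulVec_diagonal]

namespace RealGrassmannian

open LinearMap.BilinForm

variable {i : ℕ} {X : Type*} [NormedAddCommGroup X] [NormedSpace ℝ X] [FiniteDimensional ℝ X]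
  {b : LinearMap.BilinForm ℝ X}

/-- The parametrization of the graph of `A` by `ℝ^i`. -/
def graphMap (e : Splitting i X) (A : Model i X) : Sub i ≃ₗ[ℝ] (graphAt e A).1 where
  toFun u := ⟨e.symm (u, A u), symm_mem_graphAt e A u⟩
  invFun v := (e v).1
  map_add' u v := Subtype.ext (by
    change e.symm (u + v, A (u + v)) = e.symm (u, A u) + e.symm (v, A v)
    rw [← map_add, map_add, Prod.mk_add_mk])
  map_smul' c u := Subtype.ext (by
    change e.symm (c • u, A (c • u)) = c • e.symm (u, A u)
    rw [← map_smul, map_smul, Prod.smul_mk])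
  left_inv u := by simp
  right_inv v := Subtype.ext (by
    change e.symm ((e v).1, A (e v).1) = v
    rw [← mem_graphAt.1 v.2]
    simp)

theorem coe_graphMap (e : Splitting i X) (A : Model i X) (u : Sub i) :
    (graphMap e A u : X) = e.symm (u, A u) := rfl

/-- The pullback of `b` to `ℝ^i` by the parametrization of the graph of `A`. -/
def gramForm (b : LinearMap.BilinForm ℝ X) (e : Splitting i X) (A : Model i X) :
    LinearMap.BilinForm ℝ (Sub i) :=
  b.compl₁₂ ((graphAt e A).1.subtype ∘ₗ (graphMap e A).toLinearMap)
    ((graphAt e A).1.subtype ∘ₗ (graphMap e A).toLinearMap)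

theorem gramForm_apply (b : LinearMap.BilinForm ℝ X) (e : Splitting i X) (A : Model i X)
    (u v : Sub i) : gramForm b e A u v = b (e.symm (u, A u)) (e.symm (v, A v)) := rfl

/-- The Gram determinant of `b` on the graph of `A`. -/
def gramDet (b : LinearMap.BilinForm ℝ X) (e : Splitting i X) (A : Model i X) : ℝ :=
  (LinearMap.BilinForm.toMatrix (Pi.basisFun ℝ (Fin i)) (gramForm b e A)).det

/-- Allows computing in a basis `P` adapted to one subspace: the change of basis contributes a
nonzero factor that does not depend on `A`. -/
theorem det_toMatrix_gramForm (b : LinearMap.BilinForm ℝ X) (e : Splitting i X) (A : Model i X)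
    (P : Module.Basis (Fin i) ℝ (Sub i)) :
    (LinearMap.BilinForm.toMatrix P (gramForm b e A)).det =
      ((Pi.basisFun ℝ (Fin i)).toMatrix P).det ^ 2 * gramDet b e A := by
  rw [← LinearMap.BilinForm.toMatrix_mul_basis_toMatrix (Pi.basisFun ℝ (Fin i)) P, Matrix.det_mul,
    Matrix.det_mul, Matrix.det_transpose, gramDet]
  ring

theorem contDiff_graphMap (e : Splitting i X) (u : Sub i) {n : ℕ∞ω} :
    ContDiff ℝ n fun A : Model i X => e.symm (u, A u) :=
  e.symm.contDiff.comp (contDiff_const.prodMk (contDiff_id.clm_apply contDiff_const))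

theorem contDiff_gramDet (b : LinearMap.BilinForm ℝ X) (e : Splitting i X) {n : ℕ∞ω} :
    ContDiff ℝ n (gramDet b e) := by
  refine contDiff_matrix_det fun j k => ?_
  simp only [LinearMap.BilinForm.toMatrix_apply, gramForm_apply]
  exact b.contDiff_apply (contDiff_graphMap e _) (contDiff_graphMap e _)

theorem equivalent_gramForm (b : LinearMap.BilinForm ℝ X) (e : Splitting i X) (A : Model i X) :
    (gramForm b e A).toQuadraticMap.Equivalent (b.toQuadraticMap.restrict (graphAt e A).1) :=
  ⟨⟨graphMap e A, fun _ => rfl⟩⟩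

/-- The basis of `ℝ^i` that corresponds to a diagonalizing basis of the graph of `A`. -/
theorem exists_basis_graphMap {e : Splitting i X} {A : Model i X} {v : Fin i → X}
    {w : Fin i → SignType} (hv : b.IsSignBasis (graphAt e A).1 v w) :
    ∃ P : Module.Basis (Fin i) ℝ (Sub i), ∀ j, e.symm (P j, A (P j)) = v j := by
  have hmem (j : Fin i) : v j ∈ (graphAt e A).1 :=
    hv.span_eq ▸ Submodule.subset_span (Set.mem_range_self j)
  let p : Fin i → Sub i := fun j => (graphMap e A).symm ⟨v j, hmem j⟩
  have hp (j : Fin i) : e.symm (p j, A (p j)) = v j := by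
    rw [← coe_graphMap]
    simp [p]
  have hli : LinearIndependent ℝ p := by
    refine LinearIndependent.of_comp
      ((graphAt e A).1.subtype ∘ₗ (graphMap e A).toLinearMap) ?_
    convert! hv.linearIndependent (graphAt e A).2 using 1
    ext1 j
    exact hp j
  refine ⟨basisOfLinearIndependentOfCardEqFinrank' p hli (by simp), fun j => ?_⟩
  rw [coe_basisOfLinearIndependentOfCardEqFinrank', hp]

theorem det_toMatrix_basis_sq_ne_zero (P : Module.Basis (Fin i) ℝ (Sub i)) :
    ((Pi.basisFun ℝ (Fin i)).toMatrix P).det ^ 2 ≠ 0 :=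
  pow_ne_zero 2 (by
    have := (Pi.basisFun ℝ (Fin i)).isUnit_det P
    rw [Module.Basis.det_apply] at this
    exact this.ne_zero)

/-- In the diagonalizing basis the Gram matrix is diagonal, with the signs `w` as its entries. -/
theorem gramDet_eq_zero_iff {e : Splitting i X} {A : Model i X} {v : Fin i → X}
    {w : Fin i → SignType} (hv : b.IsSignBasis (graphAt e A).1 v w) :
    gramDet b e A = 0 ↔ ∃ j, w j = 0 := by
  obtain ⟨P, hP⟩ := exists_basis_graphMap hv
  have h := det_toMatrix_gramForm b e A P
  have hM : LinearMap.BilinForm.toMatrix P (gramForm b e A) =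
      Matrix.diagonal fun j => (w j : ℝ) := by
    ext j k
    rw [LinearMap.BilinForm.toMatrix_apply, gramForm_apply, hP, hP]
    by_cases hjk : j = k
    · subst hjk
      rw [hv.apply_self, Matrix.diagonal_apply_eq]
    · rw [hv.apply_ne hjk, Matrix.diagonal_apply_ne _ hjk]
  rw [hM, Matrix.det_diagonal] at h
  rw [← mul_eq_zero_iff_left (det_toMatrix_basis_sq_ne_zero P), ← h, Finset.prod_eq_zero_iff]
  refine exists_congr fun j => ?_
  cases w j <;> simp

/-- Positive definiteness is an open condition: on a maximal positive definite subspace `S` of `ℝ^i`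
the form is positive on the compact unit sphere, remains so for nearby `A`, and is then positive
definite on `S` by scaling. -/
theorem eventually_le_sigPos (b : LinearMap.BilinForm ℝ X) (e : Splitting i X) (A₀ : Model i X) :
    ∀ᶠ A in 𝓝 A₀, sigPos (b.toQuadraticMap.restrict (graphAt e A₀).1) ≤
      sigPos (b.toQuadraticMap.restrict (graphAt e A).1) := by
  rw [← (equivalent_gramForm b e A₀).sigPos_eq]
  obtain ⟨S, hS, hpos⟩ := exists_finrank_eq_sigPos_and_posDef (gramForm b e A₀).toQuadraticMap
  have hK : IsCompact ((S : Set (Sub i)) ∩ Metric.sphere 0 1) :=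
    (isCompact_sphere 0 1).inter_left S.closed_of_finiteDimensional
  have hcont : Continuous fun z : Model i X × Sub i => gramForm b e z.1 z.2 z.2 := by
    have h1 : ContDiff ℝ 0 fun z : Model i X × Sub i => e.symm (z.2, z.1 z.2) :=
      e.symm.contDiff.comp (contDiff_snd.prodMk (contDiff_fst.clm_apply contDiff_snd))
    exact (b.contDiff_apply h1 h1).continuous
  have hev : ∀ᶠ A in 𝓝 A₀, ∀ u ∈ (S : Set (Sub i)) ∩ Metric.sphere 0 1,
      0 < gramForm b e A u u := by
    refine hK.eventually_forall_of_forall_eventually fun u hu => ?_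
    refine hcont.continuousAt.eventually (lt_mem_nhds ?_)
    refine hpos ⟨u, hu.1⟩ fun h0 => ?_
    have : u = 0 := congrArg Subtype.val h0
    simpa [this] using hu.2
  filter_upwards [hev] with A hA
  rw [← (equivalent_gramForm b e A).sigPos_eq, ← hS]
  refine le_sigPos_of_posDef _ fun u hu => ?_
  have hu0 : (u : Sub i) ≠ 0 := fun h => hu (Subtype.ext h)
  have hn : ‖(u : Sub i)‖ ≠ 0 := norm_ne_zero_iff.2 hu0
  have := hA (‖(u : Sub i)‖⁻¹ • (u : Sub i)) ⟨S.smul_mem _ u.2, by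
    rw [mem_sphere_zero_iff_norm, norm_smul, norm_inv, norm_norm, inv_mul_cancel₀ hn]⟩
  rw [map_smul, LinearMap.map_smul₂, smul_eq_mul, smul_eq_mul, ← mul_assoc] at this
  exact (pos_iff_pos_of_mul_pos this).1 (by positivity)

/-- Negating the form turns the negative index into the positive one. -/
theorem eventually_le_sigNeg (b : LinearMap.BilinForm ℝ X) (e : Splitting i X) (A₀ : Model i X) :
    ∀ᶠ A in 𝓝 A₀, sigNeg (b.toQuadraticMap.restrict (graphAt e A₀).1) ≤
      sigNeg (b.toQuadraticMap.restrict (graphAt e A).1) :=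
  eventually_le_sigPos (-b) e A₀

/-- Locally, the subspaces of signature `(r, s)` and dimension `r + s + 1` are the zeros of the Gram
determinant. -/
theorem eventually_signature_iff_gramDet_eq_zero (hb : b.IsSymm) {r s : ℕ} (hrs : r + s + 1 = i)
    {e : Splitting i X} {A₀ : Model i X}
    (hr : sigPos (b.toQuadraticMap.restrict (graphAt e A₀).1) = r)
    (hs : sigNeg (b.toQuadraticMap.restrict (graphAt e A₀).1) = s) :
    ∀ᶠ A in 𝓝 A₀, (sigPos (b.toQuadraticMap.restrict (graphAt e A).1) = r ∧
      sigNeg (b.toQuadraticMap.restrict (graphAt e A).1) = s) ↔ gramDet b e A = 0 := by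
  filter_upwards [eventually_le_sigPos b e A₀, eventually_le_sigNeg b e A₀] with A h1 h2
  rw [hr] at h1
  rw [hs] at h2
  obtain ⟨v, w, hv, hvr, hvs⟩ := exists_isSignBasis hb (graphAt e A).1 (graphAt e A).2
  rw [gramDet_eq_zero_iff hv]
  constructor
  · rintro ⟨h3, h4⟩
    obtain ⟨-, j₀, hj₀⟩ := exists_eq_zero_iff hrs (hvr.symm.trans h3) (hvs.symm.trans h4)
    exact ⟨j₀, (hj₀ j₀).2 rfl⟩
  -- The signs number `r + s + 1`, with at least one zero, `r` positive and `s` negative ones, so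
  -- all three bounds are sharp.
  · rintro ⟨j, hj⟩
    have h3 : Fintype.card {j // w j = 0} + Fintype.card {j // w j = 1} +
        Fintype.card {j // w j = -1} = i := card_signType_fibers w
    have h4 : 0 < Fintype.card {j // w j = 0} := Fintype.card_pos_iff.2 ⟨j, hj⟩
    omega

/-- The derivative of the Gram determinant does not vanish in the subspaces of signature `(r, s)`
and dimension `r + s + 1`. -/
theorem fderiv_gramDet_ne_zero (hb : b.IsSymm) (hnd : b.Nondegenerate) {r s : ℕ}
    (hrs : r + s + 1 = i) {e : Splitting i X} {A₀ : Model i X}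
    (hr : sigPos (b.toQuadraticMap.restrict (graphAt e A₀).1) = r)
    (hs : sigNeg (b.toQuadraticMap.restrict (graphAt e A₀).1) = s) :
    fderiv ℝ (gramDet b e) A₀ ≠ 0 := by
  classical
  obtain ⟨v, w, hv, hvr, hvs⟩ := exists_isSignBasis hb (graphAt e A₀).1 (graphAt e A₀).2
  obtain ⟨-, j₀, hj₀⟩ := exists_eq_zero_iff hrs (hvr.symm.trans hr) (hvs.symm.trans hs)
  obtain ⟨P, hP⟩ := exists_basis_graphMap hv
  have hn0 (k : Fin i) : b (v j₀) (v k) = 0 := by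
    by_cases hk : j₀ = k
    · rw [← hk, hv.apply_self, (hj₀ j₀).2 rfl, SignType.coe_zero]
    · exact hv.apply_ne hk
  -- Otherwise the null vector `v j₀`, being orthogonal to the graph, would also be orthogonal to a
  -- complement of it, hence to everything.
  obtain ⟨y, hy⟩ : ∃ y : Quo i X, b (v j₀) (e.symm (0, y)) ≠ 0 := by
    by_contra! h
    refine (hv.linearIndependent (graphAt e A₀).2).ne_zero j₀ (hnd.1 _ fun x => ?_)
    have hx : x = e.symm ((e x).1, A₀ (e x).1) + e.symm (0, (e x).2 - A₀ (e x).1) := by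
      rw [← map_add, Prod.mk_add_mk, add_zero, add_sub_cancel]
      simp
    rw [hx, map_add, h, add_zero]
    have hle : (graphAt e A₀).1 ≤ LinearMap.ker (b (v j₀)) := by
      rw [← hv.span_eq, Submodule.span_le]
      rintro _ ⟨k, rfl⟩
      exact hn0 k
    exact hle (symm_mem_graphAt e A₀ (e x).1)
  -- The tangent direction `B` moves only the null basis vector, with velocity `y'`.
  obtain ⟨B, hB⟩ : ∃ B : Model i X, ∀ j, B (P j) = Pi.single (M := fun _ => Quo i X) j₀ y j :=
    ⟨LinearMap.toContinuousLinearMap (P.constr ℝ (Pi.single j₀ y)), by simp⟩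
  let y' : X := e.symm (0, y)
  have hframe (t : ℝ) (j : Fin i) : e.symm (P j, (A₀ + t • B) (P j)) =
      v j + (if j = j₀ then t else 0) • y' := by
    have : e.symm (P j, (A₀ + t • B) (P j)) = e.symm (P j, A₀ (P j)) + t • e.symm (0, B (P j)) := by
      rw [← map_smul, ← map_add]
      simp
    rw [this, hP, hB]
    by_cases hj : j = j₀
    · subst hj
      simp [y']
    · simp only [Pi.single_eq_of_ne hj, if_neg hj, zero_smul]
      rw [← Prod.zero_eq_mk, map_zero, smul_zero]
  let G (t : ℝ) : Matrix (Fin i) (Fin i) ℝ :=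
    LinearMap.BilinForm.toMatrix P (gramForm b e (A₀ + t • B))
  have hG (t : ℝ) (j k : Fin i) : G t j k =
      b (v j + (if j = j₀ then t else 0) • y') (v k + (if k = j₀ then t else 0) • y') := by
    change LinearMap.BilinForm.toMatrix P (gramForm b e (A₀ + t • B)) j k = _
    rw [LinearMap.BilinForm.toMatrix_apply, gramForm_apply, hframe, hframe]
  -- Row `j₀` of `G t` is divisible by `t`, as `v j₀` is orthogonal to the graph of `A₀`; `h t` is
  -- the quotient. Its diagonal entry at `t = 0` is `2 b (v j₀) y'`.
  let h (t : ℝ) : Fin i → ℝ := fun k => b y' (v k) +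
    (if k = j₀ then b (v j₀) y' + t * b y' y' else 0)
  have hGh (t : ℝ) : (G t).updateRow j₀ (t • h t) = G t := by
    ext j k
    by_cases hj : j = j₀
    swap
    · rw [Matrix.updateRow_ne hj]
    rw [hj, Matrix.updateRow_self, hG, if_pos rfl]
    by_cases hk : k = j₀
    · simp [h, hk, hn0]
      ring
    · simp [h, hk, hn0]
  let F (t : ℝ) : ℝ := ((G t).updateRow j₀ (h t)).det
  have hF (t : ℝ) : ((Pi.basisFun ℝ (Fin i)).toMatrix P).det ^ 2 * gramDet b e (A₀ + t • B) =
      t * F t := by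
    rw [← det_toMatrix_gramForm]
    change (G t).det = _
    rw [← hGh t, Matrix.det_updateRow_smul]
  have hF0 : F 0 ≠ 0 := by
    have hG0 : G 0 = Matrix.diagonal fun j => (w j : ℝ) := by
      ext j k
      rw [hG]
      by_cases hjk : j = k
      · subst hjk
        simp [hv.apply_self]
      · simp [hjk, hv.apply_ne hjk]
    change ((G 0).updateRow j₀ (h 0)).det ≠ 0
    rw [hG0, Matrix.det_updateRow_diagonal]
    refine mul_ne_zero (Finset.prod_ne_zero_iff.2 fun j hj => ?_) ?_
    · have : w j ≠ 0 := fun h => Finset.ne_of_mem_erase hj ((hj₀ j).1 h)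
      revert this
      cases w j <;> simp
    · simp only [h, if_pos, zero_mul, add_zero, hb.swap y' (v j₀)]
      change b (v j₀) y' ≠ 0 at hy
      intro h'
      exact hy (by linarith)
  have hFd : Differentiable ℝ F := by
    refine (contDiff_matrix_det (n := 1) fun j k => ?_).differentiable one_ne_zero
    by_cases hj : j = j₀
    · subst hj
      simp only [Matrix.updateRow_self, h]
      split_ifs <;> fun_prop
    · simp only [Matrix.updateRow_ne hj, hG]
      refine b.contDiff_apply ?_ ?_ <;> split_ifs <;> fun_prop
  -- By `hF`, the nonzero number `F 0` is a constant times the derivative of the Gram determinant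
  -- along `B`.
  have hd1 : HasDerivAt (fun t => t * F t) (F 0) 0 := by
    simpa using! (hasDerivAt_id (0 : ℝ)).mul (hFd 0).hasDerivAt
  have hd2 : HasDerivAt (fun t : ℝ => gramDet b e (A₀ + t • B)) (fderiv ℝ (gramDet b e) A₀ B) 0 := by
    have h1 : HasDerivAt (fun t : ℝ => A₀ + t • B) B 0 := by
      simpa using ((hasDerivAt_id (0 : ℝ)).smul_const B).const_add A₀
    have h2 : HasFDerivAt (gramDet b e) (fderiv ℝ (gramDet b e) A₀) (A₀ + (0 : ℝ) • B) := by
      rw [zero_smul, add_zero]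
      exact ((contDiff_gramDet b e (n := 1)).differentiable one_ne_zero A₀).hasFDerivAt
    exact h2.comp_hasDerivAt 0 h1
  have hd3 := hd2.const_mul (((Pi.basisFun ℝ (Fin i)).toMatrix P).det ^ 2)
  simp only [hF] at hd3
  intro h0
  rw [h0, _root_.zero_apply, mul_zero] at hd3
  exact hF0 (hd1.unique hd3)

end RealGrassmannian

/-! ### Regular zero sets -/

section RegularZeros

variable {E : Type*} [NormedAddCommGroup E] [NormedSpace ℝ E]

/-- Around a regular point, a smooth function is a linear function in suitable coordinates. -/
theorem exists_openPartialHomeomorph_fderiv_comp_eq [CompleteSpace E] {f : E → ℝ}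
    (hf : ContDiff ℝ ∞ f) {a : E} (hfa : fderiv ℝ f a ≠ 0) {s : Set E} (hs : s ∈ 𝓝 a) :
    ∃ ψ : OpenPartialHomeomorph E E, a ∈ ψ.source ∧ ψ.source ⊆ s ∧
      ContDiffOn ℝ ∞ ψ ψ.source ∧ ContDiffOn ℝ ∞ ψ.symm ψ.target ∧
      ∀ x, fderiv ℝ f a (ψ x) = f x := by
  obtain ⟨B, hB⟩ : ∃ B, fderiv ℝ f a B = 1 := by
    obtain ⟨y, hy⟩ : ∃ y, fderiv ℝ f a y ≠ 0 := by
      by_contra! h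
      exact hfa (ContinuousLinearMap.ext h)
    exact ⟨(fderiv ℝ f a y)⁻¹ • y, by rw [map_smul, smul_eq_mul, inv_mul_cancel₀ hy]⟩
  -- The correction along `B`, normalized by `fderiv ℝ f a B = 1`, makes `fderiv ℝ f a ∘ Φ = f` hold
  -- exactly. It vanishes to first order at `a` up to a constant, so `Φ` has the identity as its
  -- derivative there.
  let Φ : E → E := fun x => x + (f x - fderiv ℝ f a x) • B
  have hΦ : ContDiff ℝ ∞ Φ :=
    contDiff_id.add ((hf.sub (fderiv ℝ f a).contDiff).smul contDiff_const)
  have hΦa : HasFDerivAt Φ ((ContinuousLinearEquiv.refl ℝ E : E ≃L[ℝ] E) : E →L[ℝ] E) a := by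
    have h1 : HasFDerivAt f (fderiv ℝ f a) a :=
      (hf.differentiable (by simp) a).hasFDerivAt
    have h2 := (hasFDerivAt_id a).add ((h1.sub (fderiv ℝ f a).hasFDerivAt).smul_const B)
    convert! h2 using 1
    ext x
    simp
  have hinv : ∀ᶠ x in 𝓝 a, fderiv ℝ Φ x ∈ range ((↑) : (E ≃L[ℝ] E) → E →L[ℝ] E) := by
    refine (hΦ.continuous_fderiv (by simp)).continuousAt.eventually ?_
    rw [hΦa.fderiv]
    exact ContinuousLinearEquiv.nhds _
  -- Restricting to points with invertible derivative makes the inverse smooth on the whole target,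
  -- not only at the image of `a`.
  obtain ⟨O, hO, hOo, haO⟩ := mem_nhds_iff.1 (Filter.inter_mem hs hinv)
  let ψ₀ := hΦ.contDiffAt.toOpenPartialHomeomorph Φ hΦa (by simp)
  refine ⟨ψ₀.restrOpen O hOo, ?_, ?_, ?_, ?_, fun x => ?_⟩
  · rw [OpenPartialHomeomorph.restrOpen_source]
    exact ⟨hΦ.contDiffAt.mem_toOpenPartialHomeomorph_source hΦa (by simp), haO⟩
  · rw [OpenPartialHomeomorph.restrOpen_source]
    exact fun x hx => (hO hx.2).1
  · exact hΦ.contDiffOn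
  · intro y hy
    have hy' := (ψ₀.restrOpen O hOo).map_target hy
    rw [OpenPartialHomeomorph.restrOpen_source] at hy'
    obtain ⟨L, hL⟩ := (hO hy'.2).2
    refine ((ψ₀.restrOpen O hOo).contDiffAt_symm hy (f₀' := L) ?_ hΦ.contDiffAt).contDiffWithinAt
    rw [hL]
    exact (hΦ.differentiable (by simp) _).hasFDerivAt
  · change fderiv ℝ f a (x + (f x - fderiv ℝ f a x) • B) = f x
    rw [map_add, map_smul, hB, smul_eq_mul, mul_one, add_sub_cancel]

/-- Locally, regular zero sets of functions are submanifolds of codimension one. -/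
theorem IsEmbeddedSubmanifold.of_regular_zeros [CompleteSpace E] {M : Type*} [TopologicalSpace M]
    [ChartedSpace E M] [IsManifold 𝓘(ℝ, E) ∞ M] {N : Set M}
    (h : ∀ x ∈ N, ∃ φ ∈ IsManifold.maximalAtlas 𝓘(ℝ, E) ∞ M, x ∈ φ.source ∧
      ∃ f : E → ℝ, ContDiff ℝ ∞ f ∧ fderiv ℝ f (φ x) ≠ 0 ∧
        ∀ᶠ a in 𝓝 (φ x), φ.symm a ∈ N ↔ f a = 0) :
    IsEmbeddedSubmanifold (E := E) N 1 := by
  intro x hx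
  obtain ⟨φ, hφ, hxφ, f, hf, hf', hN⟩ := h x hx
  obtain ⟨ψ, hxψ, hψN, hψ, hψ', hψf⟩ := exists_openPartialHomeomorph_fderiv_comp_eq hf hf' hN
  -- In the chart straightened by `ψ`, the zero set of `f` is the kernel of its derivative at `φ x`.
  refine ⟨φ.trans ψ, ?_, ⟨hxφ, hxψ⟩, LinearMap.ker (fderiv ℝ f (φ x) : E →ₗ[ℝ] ℝ), ?_, ?_, ?_⟩
  · refine OpenPartialHomeomorph.mem_maximalAtlas_of_contMDiffOn _ ?_ ?_
    · exact hψ.contMDiffOn.comp' (contMDiffOn_of_mem_maximalAtlas hφ)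
    · exact (contMDiffOn_symm_of_mem_maximalAtlas hφ).comp' hψ'.contMDiffOn
  · have hsurj : Function.Surjective (fderiv ℝ f (φ x) : E →ₗ[ℝ] ℝ) := by
      refine LinearMap.surjective fun h0 => hf' ?_
      ext v
      exact LinearMap.congr_fun h0 v
    rw [(LinearMap.quotKerEquivOfSurjective _ hsurj).finrank_eq, Module.finrank_self]
  · exact (fderiv ℝ f (φ x)).isClosed_ker
  · have key (y : M) (hy : y ∈ (φ.trans ψ).source) :
        y ∈ N ↔ φ.trans ψ y ∈ LinearMap.ker (fderiv ℝ f (φ x) : E →ₗ[ℝ] ℝ) := by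
      have h1 : φ.symm (φ y) ∈ N ↔ f (φ y) = 0 := hψN hy.2
      rw [φ.left_inv hy.1] at h1
      rw [h1, LinearMap.mem_ker, ← hψf]
      rfl
    ext y
    exact ⟨fun hy => ⟨hy.2, (key y hy.2).1 hy.1⟩, fun hy => ⟨(key y hy.1).2 hy.2, hy.1⟩⟩

end RegularZeros

/-! ### The section in a chart and its covariant derivative -/

namespace RealGrassmannian

open LinearMap.BilinForm

variable {i : ℕ} {X : Type*} [NormedAddCommGroup X] [NormedSpace ℝ X] [FiniteDimensional ℝ X]
  {b : LinearMap.BilinForm ℝ X}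

theorem trivializationAt_apply_snd (V : RealGrassmannian i X)
    (p : TotalSpace ℝ (Density (i := i) (X := X))) :
    (trivializationAt ℝ (Density (i := i) (X := X)) V p).2 =
      evalForm p.1 p.2 (wedgeAt (splittingAt V) p.1) (wedgeAt (splittingAt V) p.1) := rfl

/-- The induced form on a decomposable vector is the determinant of pairings of its factors, here
the members of the frame of the graph. -/
theorem evalForm_sectionOf (hb : b.IsSymm) {e : Splitting i X} {V : RealGrassmannian i X}
    (h : V ∈ (grChart e).source) :
    evalForm V (sectionOf b hb V) (wedgeAt e V) (wedgeAt e V) = gramDet b e (grChart e V) := by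
  change extForm i b (exteriorPower.map i V.1.subtype (wedgeAt e V))
    (exteriorPower.map i V.1.subtype (wedgeAt e V)) = _
  rw [wedgeAt, exteriorPower.map_apply_ιMulti, extForm_ιMulti, gramDet]
  congr 1
  ext j k
  simp only [Matrix.of_apply, Function.comp_apply, Submodule.subtype_apply, coe_frameAt h,
    LinearMap.BilinForm.toMatrix_apply, gramForm_apply, Pi.basisFun_apply]

theorem sectionOf_eq_smul (hb : b.IsSymm) {e : Splitting i X} {V : RealGrassmannian i X}
    (h : V ∈ (grChart e).source) :
    sectionOf b hb V = gramDet b e (grChart e V) • volSqAt e V := by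
  rw [← evalForm_sectionOf hb h, evalForm_smul_volSqAt h]

theorem contMDiffOn_grChart (e : Splitting i X) :
    ContMDiffOn 𝓘(ℝ, Model i X) 𝓘(ℝ, Model i X) ∞ (grChart e) (grChart e).source :=
  contMDiffOn_of_mem_maximalAtlas (IsManifold.subset_maximalAtlas (grHomeo_mem_atlas e))

theorem grChart_source_mem_nhds {e : Splitting i X} {V : RealGrassmannian i X}
    (h : V ∈ (grChart e).source) : (grChart e).source ∈ 𝓝 V :=
  (isOpen_grChart_source e).mem_nhds h

theorem contMDiff_sectionOf (hb : b.IsSymm) :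
    ContMDiff 𝓘(ℝ, Model i X) (𝓘(ℝ, Model i X).prod 𝓘(ℝ, ℝ)) ∞
      fun V : RealGrassmannian i X => TotalSpace.mk' ℝ V (sectionOf b hb V) := by
  intro V
  rw [contMDiffAt_section]
  have hV := grChart_source_mem_nhds (mem_splittingAt V)
  have h1 : ContMDiffAt 𝓘(ℝ, Model i X) 𝓘(ℝ, ℝ) ∞
      (fun V' => gramDet b (splittingAt V) (grChart (splittingAt V) V')) V :=
    (contDiff_gramDet b (splittingAt V)).contMDiff.contMDiffAt.comp V
      ((contMDiffOn_grChart (splittingAt V)).contMDiffAt hV)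
  refine h1.congr_of_eventuallyEq ?_
  filter_upwards [hV] with V' hV'
  rw [trivializationAt_apply_snd, evalForm_sectionOf hb hV']

/-- In the trivialization at `V` this local frame of `L` is the constant `1`. -/
theorem contMDiffAt_volSqAt (V : RealGrassmannian i X) :
    ContMDiffAt 𝓘(ℝ, Model i X) (𝓘(ℝ, Model i X).prod 𝓘(ℝ, ℝ)) ∞
      (fun V' : RealGrassmannian i X => TotalSpace.mk' ℝ V' (volSqAt (splittingAt V) V')) V := by
  rw [contMDiffAt_section]
  refine (contMDiffAt_const (c := (1 : ℝ))).congr_of_eventuallyEq ?_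
  filter_upwards [grChart_source_mem_nhds (mem_splittingAt V)] with V' hV'
  rw [trivializationAt_apply_snd, evalForm_volSqAt, volAt_wedgeAt_self hV', mul_one]

/-- In a zero of the section, its covariant derivative is the derivative of the Gram determinant. -/
theorem covariantDerivative_sectionOf (hb : b.IsSymm)
    (cov : CovariantDerivative 𝓘(ℝ, Model i X) ℝ (Density (i := i) (X := X)))
    {V : RealGrassmannian i X}
    (h0 : gramDet b (splittingAt V) (grChart (splittingAt V) V) = 0)
    (v : TangentSpace 𝓘(ℝ, Model i X) V) :
    cov (sectionOf b hb) V v =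
      mvfderiv 𝓘(ℝ, Model i X) (fun V' => gramDet b (splittingAt V) (grChart (splittingAt V) V')) V v •
        volSqAt (splittingAt V) V := by
  set g : RealGrassmannian i X → ℝ :=
    fun V' => gramDet b (splittingAt V) (grChart (splittingAt V) V') with hg
  have hV := grChart_source_mem_nhds (mem_splittingAt V)
  have hgd : MDifferentiableAt 𝓘(ℝ, Model i X) 𝓘(ℝ, ℝ) g V :=
    ((contDiff_gramDet b (splittingAt V) (n := ∞)).contMDiff.contMDiffAt.comp V
      ((contMDiffOn_grChart (splittingAt V)).contMDiffAt hV)).mdifferentiableAt (by simp)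
  have hs := (contMDiffAt_volSqAt V).mdifferentiableAt (by simp)
  have heq : ∀ᶠ V' in 𝓝 V, sectionOf b hb V' = (g • volSqAt (splittingAt V)) V' := by
    filter_upwards [hV] with V' hV'
    exact sectionOf_eq_smul hb hV'
  have hσ := (contMDiff_sectionOf hb V).mdifferentiableAt (by simp)
  have hgs : MDifferentiableAt 𝓘(ℝ, Model i X) (𝓘(ℝ, Model i X).prod 𝓘(ℝ, ℝ))
      (fun V' => TotalSpace.mk' ℝ V' ((g • volSqAt (splittingAt V)) V')) V := by
    refine hσ.congr_of_eventuallyEq ?_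
    filter_upwards [heq] with V' hV'
    rw [hV']
  -- A connection is local, so the section may be replaced by `g` times the local frame; in the
  -- Leibniz rule the term with the derivative of the frame has the factor `g V = 0`.
  rw [cov.isCovariantDerivativeOnUniv.congr_of_eventuallyEq hσ hgs Filter.univ_mem heq,
    cov.isCovariantDerivativeOnUniv.leibniz hs hgd (mem_univ V), hg]
  simp only [h0]
  simp

/-- Composing with the inverse chart `graphAt e` recovers `gramDet b e`, so by the chain rule a zero
differential on the manifold would force a zero derivative in the model. -/
theorem mvfderiv_gramDet_ne_zero {V : RealGrassmannian i X}
    (h : fderiv ℝ (gramDet b (splittingAt V)) (grChart (splittingAt V) V) ≠ 0) :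
    ∃ v : TangentSpace 𝓘(ℝ, Model i X) V, mvfderiv 𝓘(ℝ, Model i X)
      (fun V' => gramDet b (splittingAt V) (grChart (splittingAt V) V')) V v ≠ 0 := by
  by_contra! h0
  set e := splittingAt V
  set g : RealGrassmannian i X → ℝ := fun V' => gramDet b e (grChart e V') with hg
  have hgd : MDifferentiableAt 𝓘(ℝ, Model i X) 𝓘(ℝ, ℝ) g V :=
    ((contDiff_gramDet b e (n := ∞)).contMDiff.contMDiffAt.comp V
      ((contMDiffOn_grChart e).contMDiffAt
        (grChart_source_mem_nhds (mem_splittingAt V)))).mdifferentiableAt (by simp)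
  have hg0 : mfderiv 𝓘(ℝ, Model i X) 𝓘(ℝ, ℝ) g V = 0 :=
    ContinuousLinearMap.ext h0
  have hV : graphAt e (grChart e V) = V := graphAt_grChart (mem_splittingAt V)
  have hsymm : MDifferentiableAt 𝓘(ℝ, Model i X) 𝓘(ℝ, Model i X) (graphAt e) (grChart e V) :=
    ((contMDiffOn_symm_of_mem_maximalAtlas (n := ∞)
      (IsManifold.subset_maximalAtlas (grHomeo_mem_atlas e))).contMDiffAt
        (Filter.univ_mem)).mdifferentiableAt (by simp)
  have hgd' : HasMFDerivAt 𝓘(ℝ, Model i X) 𝓘(ℝ, ℝ) g (graphAt e (grChart e V))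
      (mfderiv 𝓘(ℝ, Model i X) 𝓘(ℝ, ℝ) g (graphAt e (grChart e V))) := by
    rw [hV]
    exact hgd.hasMFDerivAt
  have hcomp := hgd'.comp (grChart e V) hsymm.hasMFDerivAt
  have hfun : g ∘ graphAt e = gramDet b e := by
    ext A
    simp only [hg, Function.comp_apply, grChart_graphAt]
  rw [hfun] at hcomp
  have h1 : HasMFDerivAt 𝓘(ℝ, Model i X) 𝓘(ℝ, ℝ) (gramDet b e) (grChart e V)
      (0 : Model i X →L[ℝ] ℝ) := by
    rw [hV, hg0] at hcomp
    exact hcomp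
  exact h (HasFDerivAt.fderiv (hasMFDerivAt_iff_hasFDerivAt.1 h1))

/-- The section defined by a nondegenerate form is a defining section for the set of the subspaces
of signature `(r, s)`. -/
theorem isDefiningSection_sectionOf (hb : b.IsSymm) (hnd : b.Nondegenerate) {r s : ℕ}
    (hrs : r + s + 1 = i) :
    IsDefiningSection (Model i X) ℝ (fun V => sectionOf b hb V)
      {V : RealGrassmannian i X | sigPos (b.toQuadraticMap.restrict V.1) = r ∧
        sigNeg (b.toQuadraticMap.restrict V.1) = s} := by
  have hgraph (V : RealGrassmannian i X) :
      graphAt (splittingAt V) (grChart (splittingAt V) V) = V :=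
    graphAt_grChart (mem_splittingAt V)
  have hzero (V : RealGrassmannian i X) (hr : sigPos (b.toQuadraticMap.restrict V.1) = r)
      (hs : sigNeg (b.toQuadraticMap.restrict V.1) = s) :
      gramDet b (splittingAt V) (grChart (splittingAt V) V) = 0 := by
    refine (eventually_signature_iff_gramDet_eq_zero hb hrs ?_ ?_).self_of_nhds.1 ⟨?_, ?_⟩ <;>
      rwa [hgraph]
  have hderiv (V : RealGrassmannian i X) (hr : sigPos (b.toQuadraticMap.restrict V.1) = r)
      (hs : sigNeg (b.toQuadraticMap.restrict V.1) = s) :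
      fderiv ℝ (gramDet b (splittingAt V)) (grChart (splittingAt V) V) ≠ 0 := by
    refine fderiv_gramDet_ne_zero hb hnd hrs ?_ ?_ <;> rwa [hgraph]
  refine ⟨?_, contMDiff_sectionOf hb, fun V hV => ?_, fun cov V hV z => ?_⟩
  · rw [Module.finrank_self]
    refine IsEmbeddedSubmanifold.of_regular_zeros fun V hV => ?_
    refine ⟨grHomeo (splittingAt V), IsManifold.subset_maximalAtlas (grHomeo_mem_atlas _),
      mem_splittingAt V, gramDet b (splittingAt V), contDiff_gramDet b _, hderiv V hV.1 hV.2, ?_⟩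
    refine eventually_signature_iff_gramDet_eq_zero hb hrs
      (A₀ := grChart (splittingAt V) V) ?_ ?_ <;> rw [hgraph]
    exacts [hV.1, hV.2]
  · rw [sectionOf_eq_smul hb (mem_splittingAt V), hzero V hV.1 hV.2, zero_smul]
  · obtain ⟨v, hv⟩ := mvfderiv_gramDet_ne_zero (hderiv V hV.1 hV.2)
    set c := mvfderiv 𝓘(ℝ, Model i X)
      (fun V' => gramDet b (splittingAt V) (grChart (splittingAt V) V')) V v with hc
    set d := evalForm V z (wedgeAt (splittingAt V) V) (wedgeAt (splittingAt V) V) with hd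
    -- The fibre is a line with generator `volSqAt`, in which `z` has coordinate `d` and the image
    -- of `v` has coordinate `c ≠ 0`.
    refine ⟨(d * c⁻¹) • v, ?_⟩
    rw [covariantDerivative_sectionOf hb cov (hzero V hV.1 hV.2), ContinuousLinearMap.map_smul,
      ← hc, smul_eq_mul, mul_assoc, inv_mul_cancel₀ hv, mul_one, hd,
      evalForm_smul_volSqAt (mem_splittingAt V)]

end RealGrassmannian

end

theorem proposition3p4 (p q i r s : ℕ) (hrs : r + s + 1 = i) :
    IsDefiningSection (RealGrassmannian.Model i (PseudoSpace p q)) ℝ (stdSection p q i) (signatureStratum p q i r s) ∧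
      ∀ V ∈ signatureStratum p q i r s,
        IsDefiningSection (RealGrassmannian.Model i (PseudoSpace p q)) ℝ (stdSection p q i)
          (MulAction.orbit (specialPseudoOrthogonal p q) V) := by
  have h : IsDefiningSection (RealGrassmannian.Model i (PseudoSpace p q)) ℝ (stdSection p q i)
      (signatureStratum p q i r s) :=
    RealGrassmannian.isDefiningSection_sectionOf (stdForm_isSymm p q) (stdForm_nondegenerate p q) hrs
  exact ⟨h, fun V hV => isDefiningSection_orbit hrs h hV⟩
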